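/- **Model.** In Fully Online Bipartite Matching an instance consists of a finite bipartite graph and a sequence of time steps in which every vertex $v$ has exactly one arrival and, later, exactly one deadline; every neighbor of $v$ arrives before the deadline of $v$. The algorithm Ranking gives each vertex $v$ an independent uniformly random rank $y_v\in[0,1)$ and starts from the empty matching; at the deadline of a vertex $v$ that is still unmatched, it matches $v$ to its unmatched neighbor of smallest rank, if $v$ has an unmatched neighbor. Ranking is $c$-competitive if on every instance the expected size of its matching is at least $c$ times the size of a maximum matching. **Theorem.** Let $\Omega$ be the Omega constant, that is, the unique real solution of $x=e^{-x}$; it satisfies $0.56714<\Omega<0.56715$. Ranking is at most $\Omega$-competitive for Fully Online Bipartite Matching: if Ranking is $c$-competitive, then $c\le\Omega\approx 0.5671$. This is witnessed by the following layered instances. For $k,h\ge 0$ let $U_1,\dots,U_h$ be groups of $k$ vertices each, with a complete bipartite graph between any two consecutive groups $U_i,U_{i+1}$, and with one pendant vertex attached to each of the $kh$ vertices of $U_1\cup\dots\cup U_h$. All vertices arrive at the beginning; then the deadlines of the vertices of $U_1$ are reached, then those of $U_2$, and so on up to $U_h$, and finally those of the pendant vertices. This graph is bipartite and its maximum matchings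 have size $kh$. Moreover: 1. As $k,h\to\infty$ (jointly, in any manner), the ratio between the expected size of the matching of Ranking and $kh$ tends to $\Omega$, and the ratio between the (random) size of the matching and $kh$ converges to $\Omega$ in probability. 2. As $k,h\to\infty$, the fraction of the $kh$ pendant vertices that are matched by Ranking converges to $2\Omega-1$ in probability. 3. Let $X_i$ be the number of vertices of $U_i$ that are unmatched right before the first deadline of a vertex of $U_i$. Then $X_i/k$ concentrates at $\Omega$ as $k,i\to\infty$: for every $\varepsilon>0$ there is $N$ such that for all $k\ge N$, all $h$ and all $i\le h$ with $i>N$, we have $\Pr\left[\,|X_i/k-\Omega|\ge\varepsilon\,\right]\le\varepsilon$. -/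

import Mathlib

open MeasureTheory Filter Topology

noncomputable section

namespace FullyOnline

/-- The two kinds of time steps of the fully online model. -/
inductive Event (V : Type*) where
  | arrival (v : V) : Event V
  | deadline (v : V) : Event V

/-- An (oblivious) instance: the underlying graph and the sequence of arrivals and deadlines.
`[a, b].Sublist events` says that `a` occurs before `b`. -/
structure Instance (V : Type*) where
  graph : SimpleGraph V
  events : List (Event V)
  nodup : events.Nodup
  complete : ∀ e : Event V, e ∈ events
  arrival_before_deadline : ∀ v : V, [Event.arrival v, Event.deadline v].Sublist events
  /-- Every edge at `v` has been revealed before the deadline of `v`. -/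
  neighbor_before_deadline : ∀ u v : V, graph.Adj u v →
    [Event.arrival u, Event.deadline v].Sublist events

/-- `v` is an endpoint of an edge of the (partial) matching `M`. -/
def IsMatched {V : Type*} (M : Finset (Sym2 V)) (v : V) : Prop := ∃ e ∈ M, v ∈ e

section Ranking

variable {V : Type*} [Fintype V]

open Classical in
/-- The unmatched neighbours of `v`, when `M` is the current matching. -/
def unmatchedNeighbors (G : SimpleGraph V) (M : Finset (Sym2 V)) (v : V) : Finset V :=
  Finset.univ.filter (fun u => G.Adj v u ∧ ¬ IsMatched M u)

open Classical in
/-- One time step of Ranking with ranks `y`: at the deadline of an unmatched vertex `v`, match `v`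
to the unmatched neighbour of smallest rank, if there is one. (Equal ranks, which have probability
zero, are resolved by a fixed enumeration.) An arrival leaves the matching unchanged; the rank
`y v` is drawn independently of everything else, so it may be thought of as fixed in advance. -/
def rankingStep (G : SimpleGraph V) (y : V → ℝ) (M : Finset (Sym2 V)) :
    Event V → Finset (Sym2 V)
  | Event.arrival _ => M
  | Event.deadline v =>
      if IsMatched M v then M
      else match (unmatchedNeighbors G M v).toList.argmin y with
        | none => M
        | some u => insert s(v, u) M

/-- The matching that Ranking produces with ranks `y`. -/
def ranking (I : Instance V) (y : V → ℝ) : Finset (Sym2 V) :=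
  I.events.foldl (rankingStep I.graph y) ∅

open Classical in
/-- The current matching of Ranking right before the event `e`. -/
def rankingBefore (I : Instance V) (y : V → ℝ) (e : Event V) : Finset (Sym2 V) :=
  (I.events.takeWhile (fun e' => decide (e' ≠ e))).foldl (rankingStep I.graph y) ∅

/-- The law of the ranks: independent and uniform on `[0, 1)`. -/
def rankLaw (V : Type*) [Fintype V] : Measure (V → ℝ) :=
  Measure.pi (fun _ => (volume : Measure ℝ).restrict (Set.Ico 0 1))

/-- The expected size of the matching produced by Ranking. -/
def expectedRanking (I : Instance V) : ℝ :=
  ∫ y, ((ranking I y).card : ℝ) ∂(rankLaw V)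

/-- The size of a maximum matching of a finite graph. -/
def maxMatching (G : SimpleGraph V) : ℕ :=
  sSup {n : ℕ | ∃ M : G.Subgraph, M.IsMatching ∧ M.edgeSet.ncard = n}

end Ranking

/-- Ranking is `c`-competitive for Fully Online Bipartite Matching: on every bipartite instance
the expected size of its matching is at least `c` times the size of a maximum matching. -/
def RankingIsCompetitive (c : ℝ) : Prop :=
  ∀ (V : Type) [Fintype V] (I : Instance V), I.graph.IsBipartite →
    c * (maxMatching I.graph : ℝ) ≤ expectedRanking I

section Layered

/-- `Sum.inl (i, a)` is the `a`-th vertex of the `i`-th group and `Sum.inr (i, a)` is the pendant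
vertex attached to it (`h` groups of `k` vertices, numbered from `0`). -/
abbrev LayeredVertex (k h : ℕ) : Type := (Fin h × Fin k) ⊕ (Fin h × Fin k)

/-- Complete bipartite graphs between consecutive groups, and a pendant vertex at each vertex. -/
def layeredAdj (k h : ℕ) : LayeredVertex k h → LayeredVertex k h → Prop
  | Sum.inl p, Sum.inl q => (p.1 : ℕ) + 1 = q.1 ∨ (q.1 : ℕ) + 1 = p.1
  | Sum.inl p, Sum.inr q => p = q
  | Sum.inr p, Sum.inl q => p = q
  | Sum.inr _, Sum.inr _ => False

def layeredGraph (k h : ℕ) : SimpleGraph (LayeredVertex k h) where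
  Adj := layeredAdj k h
  symm := ⟨by
    rintro (p | p) (q | q) hpq
    · exact Or.symm hpq
    · exact Eq.symm hpq
    · exact Eq.symm hpq
    · exact hpq⟩
  loopless := ⟨by
    rintro (p | p) hp
    · rcases hp with hp | hp <;> omega
    · exact hp⟩

/-- All index pairs `(i, a)`, group by group. -/
def layeredIndices (k h : ℕ) : List (Fin h × Fin k) :=
  (List.finRange h).product (List.finRange k)

/-- All group vertices in order, followed by all pendant vertices. -/
def layeredVertices (k h : ℕ) : List (LayeredVertex k h) :=
  (layeredIndices k h).map Sum.inl ++ (layeredIndices k h).map Sum.inr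

theorem mem_layeredVertices (k h : ℕ) (v : LayeredVertex k h) : v ∈ layeredVertices k h := by
  rcases v with ⟨i, a⟩ | ⟨i, a⟩ <;> simp [layeredVertices, layeredIndices]

theorem nodup_layeredVertices (k h : ℕ) : (layeredVertices k h).Nodup := by
  have hp : (layeredIndices k h).Nodup := (List.nodup_finRange h).product (List.nodup_finRange k)
  refine List.Nodup.append (hp.map Sum.inl_injective) (hp.map Sum.inr_injective) ?_
  intro x hx hy
  simp only [List.mem_map] at hx hy
  obtain ⟨p, _, rfl⟩ := hx
  obtain ⟨q, _, hq⟩ := hy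
  exact absurd hq (by simp)

theorem layered_before (k h : ℕ) (u v : LayeredVertex k h) :
    [Event.arrival u, Event.deadline v].Sublist
      ((layeredVertices k h).map Event.arrival ++ (layeredVertices k h).map Event.deadline) := by
  have h1 : [Event.arrival u].Sublist ((layeredVertices k h).map Event.arrival) :=
    List.singleton_sublist.2 (List.mem_map_of_mem (mem_layeredVertices k h u))
  have h2 : [Event.deadline v].Sublist ((layeredVertices k h).map Event.deadline) :=
    List.singleton_sublist.2 (List.mem_map_of_mem (mem_layeredVertices k h v))
  exact h1.append h2

/-- All vertices arrive at the beginning; then come the deadlines of the group vertices, group by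
group, and finally the deadlines of the pendant vertices. -/
def layeredInstance (k h : ℕ) : Instance (LayeredVertex k h) where
  graph := layeredGraph k h
  events := (layeredVertices k h).map Event.arrival ++ (layeredVertices k h).map Event.deadline
  nodup := by
    refine List.Nodup.append ((nodup_layeredVertices k h).map fun _ _ hab => by simpa using hab)
      ((nodup_layeredVertices k h).map fun _ _ hab => by simpa using hab) ?_
    intro x hx hy
    simp only [List.mem_map] at hx hy
    obtain ⟨p, _, rfl⟩ := hx
    obtain ⟨q, _, hq⟩ := hy
    exact absurd hq (by simp)
  complete := by
    rintro (v | v) <;> simp [mem_layeredVertices]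
  arrival_before_deadline := fun v => layered_before k h v v
  neighbor_before_deadline := fun u v _ => layered_before k h u v

open Classical in
/-- The number of pendant vertices of the layered instance that Ranking matches. -/
def matchedPendants (k h : ℕ) (y : LayeredVertex k h → ℝ) : ℕ :=
  (Finset.univ.filter
    (fun p : Fin h × Fin k => IsMatched (ranking (layeredInstance k h) y) (Sum.inr p))).card

open Classical in
/-- The number of vertices of the `i`-th group that are still unmatched right before the deadline
of the first vertex of that group. -/
def unmatchedInGroup (k h : ℕ) (hk : 0 < k) (i : Fin h) (y : LayeredVertex k h → ℝ) : ℕ :=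
  (Finset.univ.filter
    (fun a : Fin k => ¬ IsMatched
      (rankingBefore (layeredInstance k h) y (Event.deadline (Sum.inl (i, ⟨0, hk⟩))))
      (Sum.inl (i, a)))).card

end Layered

end FullyOnline

end

namespace FullyOnline

/-! Let `X_j` be the number of vertices of group `j` (numbered from 0) that are unmatched at the
first deadline of the group. A pendant vertex stays free until the deadline of its group vertex. So
every group vertex gets matched, and the deadlines of group `j` add exactly `X_j` edges
(`card_matchingBefore_self`). The matching therefore has size `∑ X_j`, and counting covered vertices
gives the number of matched pendants. Everything reduces to the behaviour of `X_j / k`.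

While group `i` is processed, the matched vertices of group `i + 1` are those of smallest rank. If
`U` of the `k` are unmatched, a still unmatched vertex of group `i` moves into group `i + 1` exactly
when more than `k - U` ranks there are at most the rank of its pendant
(`unmatchedCount_next_matchingBefore_succ`). That rank is independent of the past, and the empirical
distribution of `k` ranks is nearly uniform, so this happens with probability about `U / k`. Each of
the `X_i` active deadlines thus multiplies the expected unmatched fraction of group `i + 1` by about
`1 - 1 / k`, and the fraction ends near `(1 - 1 / k) ^ X_i`, that is, near `exp (-X_i / k)`. A
second-moment induction over the deadlines of a group makes this precise
(`integral_predictionError_sq_succ_le`): one deadline adds `1 / k` times a small quantity, so all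
`k` of them add little.

The map `x ↦ exp (-x)` contracts distances to `Ω` by the factor `9 / 10` (`abs_exp_neg_sub_le`).
Hence the mean of `|X_j / k - Ω|` is at most `(9 / 10) ^ j + ρ` once `k` is large, uniformly in `h`.
Averaging over `j` and Markov's inequality give the limits, and the limit of the expected ratio
bounds `c`. -/

/-! ### Partial matchings and one deadline on an arbitrary graph. -/

theorem argmin_congr {α : Type*} (f g : α → ℝ) (l : List α)
    (hfg : ∀ a ∈ l, ∀ b ∈ l, f a < f b ↔ g a < g b) : l.argmin f = l.argmin g := by
  induction l using List.reverseRecOn with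
  | nil => rfl
  | append_singleton l a ih =>
    have ih' := ih fun b hb c hc => hfg b (by simp [hb]) c (by simp [hc])
    rw [List.argmin_concat, List.argmin_concat, ih']
    cases hl : l.argmin g with
    | none => rfl
    | some c =>
      have hc : c ∈ l := List.argmin_mem hl
      have := hfg a (by simp) c (by simp [hc])
      simp only [this]

theorem isMatched_insert {V : Type*} [DecidableEq V] (M : Finset (Sym2 V)) (u v w : V) :
    IsMatched (insert s(u, v) M) w ↔ w = u ∨ w = v ∨ IsMatched M w := by
  simp [IsMatched, or_assoc]

theorem not_isMatched_empty {V : Type*} (w : V) : ¬ IsMatched (∅ : Finset (Sym2 V)) w := by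
  simp [IsMatched]

theorem card_insert_of_not_isMatched {V : Type*} [DecidableEq V] {M : Finset (Sym2 V)} {u v : V}
    (hu : ¬ IsMatched M u) :
    (insert s(u, v) M).card = M.card + 1 :=
  Finset.card_insert_of_notMem fun h => hu ⟨_, h, by simp⟩

section Step

variable {V : Type*} [Fintype V] {G : SimpleGraph V} {M : Finset (Sym2 V)}

theorem mem_unmatchedNeighbors {u v : V} :
    u ∈ unmatchedNeighbors G M v ↔ G.Adj v u ∧ ¬ IsMatched M u := by
  simp [unmatchedNeighbors]

theorem rankingStep_deadline_of_isMatched (y : V → ℝ) {v : V} (hv : IsMatched M v) :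
    rankingStep G y M (Event.deadline v) = M := by
  simp [rankingStep, hv]

theorem rankingStep_deadline_of_forall_isMatched (y : V → ℝ) {v : V}
    (hv : ∀ u, G.Adj v u → IsMatched M u) : rankingStep G y M (Event.deadline v) = M := by
  have : unmatchedNeighbors G M v = ∅ := by
    ext u
    simpa [mem_unmatchedNeighbors] using hv u
  simp [rankingStep, this]

theorem exists_rankingStep_deadline_eq_insert [DecidableEq V] (y : V → ℝ) {v u₀ : V}
    (hv : ¬ IsMatched M v) (hadj : G.Adj v u₀) (hu₀ : ¬ IsMatched M u₀) :
    ∃ u, G.Adj v u ∧ ¬ IsMatched M u ∧ (∀ w, G.Adj v w → ¬ IsMatched M w → y u ≤ y w) ∧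
      rankingStep G y M (Event.deadline v) = insert s(v, u) M := by
  cases hl : (unmatchedNeighbors G M v).toList.argmin y with
  | none =>
    rw [List.argmin_eq_none, Finset.toList_eq_nil] at hl
    have : u₀ ∈ unmatchedNeighbors G M v := mem_unmatchedNeighbors.2 ⟨hadj, hu₀⟩
    simp [hl] at this
  | some u =>
    have hu : u ∈ unmatchedNeighbors G M v := by simpa using List.argmin_mem hl
    obtain ⟨h1, h2⟩ := mem_unmatchedNeighbors.1 hu
    refine ⟨u, h1, h2, fun w hw hw' => ?_, ?_⟩
    · exact List.le_of_mem_argmin (f := y)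
        (by simpa using mem_unmatchedNeighbors.2 ⟨hw, hw'⟩) hl
    · simp only [rankingStep, hv, hl, if_false]
      congr 2
      exact Subsingleton.elim _ _

/-- A deadline only compares ranks of neighbours of `v`. Both order invariance and independence from
ranks not yet consulted come from this. -/
theorem rankingStep_deadline_congr {y y' : V → ℝ} (v : V)
    (hy : ∀ u, G.Adj v u → ∀ w, G.Adj v w → (y u < y w ↔ y' u < y' w)) :
    rankingStep G y M (Event.deadline v) = rankingStep G y' M (Event.deadline v) := by
  have : (unmatchedNeighbors G M v).toList.argmin y =
      (unmatchedNeighbors G M v).toList.argmin y' := by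
    refine argmin_congr _ _ _ fun a ha b hb => hy a ?_ b ?_
    · exact (mem_unmatchedNeighbors.1 (by simpa using ha)).1
    · exact (mem_unmatchedNeighbors.1 (by simpa using hb)).1
  simp [rankingStep, this]

open Classical in
theorem card_filter_isMatched_insert [DecidableEq V] {u v : V} (huv : u ≠ v) (hu : ¬ IsMatched M u)
    (hv : ¬ IsMatched M v) :
    (Finset.univ.filter fun w => IsMatched (insert s(u, v) M) w).card =
      (Finset.univ.filter fun w => IsMatched M w).card + 2 := by
  have : (Finset.univ.filter fun w => IsMatched (insert s(u, v) M) w) =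
      insert u (insert v (Finset.univ.filter fun w => IsMatched M w)) := by
    ext w
    simp [isMatched_insert]
  rw [this, Finset.card_insert_of_notMem (by simp [huv, hu]),
    Finset.card_insert_of_notMem (by simp [hv])]

end Step

/-! ### The run of Ranking on the layered graph, for fixed ranks. -/

section Layered

variable {k h : ℕ}

/-- The matching after the deadlines of the listed group vertices. -/
noncomputable def matchingAfter (y : LayeredVertex k h → ℝ) (P : List (Fin h × Fin k)) :
    Finset (Sym2 (LayeredVertex k h)) :=
  P.foldl (fun M p => rankingStep (layeredGraph k h) y M (Event.deadline (Sum.inl p))) ∅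

@[simp] theorem matchingAfter_nil (y : LayeredVertex k h → ℝ) : matchingAfter y [] = ∅ := rfl

theorem matchingAfter_concat (y : LayeredVertex k h → ℝ) (P : List (Fin h × Fin k))
    (p : Fin h × Fin k) : matchingAfter y (P ++ [p]) =
      rankingStep (layeredGraph k h) y (matchingAfter y P) (Event.deadline (Sum.inl p)) := by
  simp [matchingAfter]

@[simp] theorem layeredGraph_adj_inl_inr {p q : Fin h × Fin k} :
    (layeredGraph k h).Adj (Sum.inl p) (Sum.inr q) ↔ p = q := Iff.rfl

@[simp] theorem layeredGraph_adj_inr_inl {p q : Fin h × Fin k} :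
    (layeredGraph k h).Adj (Sum.inr p) (Sum.inl q) ↔ p = q := Iff.rfl

@[simp] theorem layeredGraph_adj_inr_inr {p q : Fin h × Fin k} :
    ¬ (layeredGraph k h).Adj (Sum.inr p) (Sum.inr q) := id

@[simp] theorem layeredGraph_adj_inl_inl {p q : Fin h × Fin k} :
    (layeredGraph k h).Adj (Sum.inl p) (Sum.inl q) ↔
      (p.1 : ℕ) + 1 = q.1 ∨ (q.1 : ℕ) + 1 = p.1 := Iff.rfl

theorem matchingAfter_congr {y y' : LayeredVertex k h → ℝ} (P : List (Fin h × Fin k))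
    (hy : ∀ p ∈ P, ∀ u, (layeredGraph k h).Adj (Sum.inl p) u →
      ∀ w, (layeredGraph k h).Adj (Sum.inl p) w → (y u < y w ↔ y' u < y' w)) :
    matchingAfter y P = matchingAfter y' P := by
  induction P using List.reverseRecOn with
  | nil => rfl
  | append_singleton P p ih =>
    rw [matchingAfter_concat, matchingAfter_concat, ih fun q hq => hy q (by simp [hq])]
    exact rankingStep_deadline_congr _ (hy p (by simp))

theorem exists_of_mem_matchingAfter (y : LayeredVertex k h → ℝ) (P : List (Fin h × Fin k))
    (e : Sym2 (LayeredVertex k h)) (he : e ∈ matchingAfter y P) :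
    ∃ p ∈ P, ∃ u, (layeredGraph k h).Adj (Sum.inl p) u ∧ e = s(Sum.inl p, u) := by
  classical
  induction P using List.reverseRecOn with
  | nil => simp at he
  | append_singleton P p ih =>
    by_cases hM : e ∈ matchingAfter y P
    · obtain ⟨q, hq, hu⟩ := ih hM
      exact ⟨q, by simp [hq], hu⟩
    · rw [matchingAfter_concat] at he
      by_cases hp : IsMatched (matchingAfter y P) (Sum.inl p)
      · rw [rankingStep_deadline_of_isMatched y hp] at he
        exact absurd he hM
      by_cases hr : ∀ u, (layeredGraph k h).Adj (Sum.inl p) u → IsMatched (matchingAfter y P) u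
      · rw [rankingStep_deadline_of_forall_isMatched y hr] at he
        exact absurd he hM
      push Not at hr
      obtain ⟨u₀, h1, h2⟩ := hr
      obtain ⟨u, hu, -, -, hs⟩ := exists_rankingStep_deadline_eq_insert y hp h1 h2
      rw [hs, Finset.mem_insert] at he
      exact ⟨p, by simp, u, hu, he.resolve_right hM⟩

/-- Pendant deadlines are not among the processed ones, so a pendant can only be taken by its unique
neighbour. -/
theorem mem_of_isMatched_inr (y : LayeredVertex k h → ℝ) (P : List (Fin h × Fin k))
    {p : Fin h × Fin k} (hp : IsMatched (matchingAfter y P) (Sum.inr p)) : p ∈ P := by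
  obtain ⟨e, he, hpe⟩ := hp
  obtain ⟨q, hq, u, hu, rfl⟩ := exists_of_mem_matchingAfter y P e he
  simp only [Sym2.mem_iff, reduceCtorEq, false_or] at hpe
  subst hpe
  rw [layeredGraph_adj_inl_inr] at hu
  exact hu ▸ hq

/-- An edge reaches at most one group beyond the vertex whose deadline adds it, so later groups are
still untouched. -/
theorem exists_of_isMatched_inl (y : LayeredVertex k h → ℝ) (P : List (Fin h × Fin k))
    {p : Fin h × Fin k} (hp : IsMatched (matchingAfter y P) (Sum.inl p)) :
    ∃ q ∈ P, (p.1 : ℕ) ≤ q.1 + 1 := by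
  obtain ⟨e, he, hpe⟩ := hp
  obtain ⟨q, hq, u, hu, rfl⟩ := exists_of_mem_matchingAfter y P e he
  rcases Sym2.mem_iff.1 hpe with hpq | rfl
  · obtain rfl := Sum.inl_injective hpq
    exact ⟨p, hq, by omega⟩
  · rw [layeredGraph_adj_inl_inl] at hu
    exact ⟨q, hq, by omega⟩

/-- The effect of the deadline of an unmatched group vertex whose pendant vertex is unmatched. -/
theorem exists_matchingAfter_concat [DecidableEq (LayeredVertex k h)] (y : LayeredVertex k h → ℝ)
    {P : List (Fin h × Fin k)}
    {p : Fin h × Fin k} (hpP : p ∉ P) (hp : ¬ IsMatched (matchingAfter y P) (Sum.inl p)) :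
    ∃ u, (layeredGraph k h).Adj (Sum.inl p) u ∧ ¬ IsMatched (matchingAfter y P) u ∧
      (∀ w, (layeredGraph k h).Adj (Sum.inl p) w → ¬ IsMatched (matchingAfter y P) w → y u ≤ y w) ∧
      matchingAfter y (P ++ [p]) = insert s(Sum.inl p, u) (matchingAfter y P) := by
  rw [matchingAfter_concat]
  exact exists_rankingStep_deadline_eq_insert (G := layeredGraph k h) y hp
    (layeredGraph_adj_inl_inr.2 rfl) (fun hr => hpP (mem_of_isMatched_inr y P hr))

theorem matchingAfter_concat_of_isMatched (y : LayeredVertex k h → ℝ) {P : List (Fin h × Fin k)}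
    {p : Fin h × Fin k} (hp : IsMatched (matchingAfter y P) (Sum.inl p)) :
    matchingAfter y (P ++ [p]) = matchingAfter y P := by
  rw [matchingAfter_concat, rankingStep_deadline_of_isMatched y hp]

theorem isMatched_matchingAfter_concat (y : LayeredVertex k h → ℝ) {P : List (Fin h × Fin k)}
    {p : Fin h × Fin k} (hpP : p ∉ P) {w : LayeredVertex k h}
    (hw : w = Sum.inl p ∨ IsMatched (matchingAfter y P) w) :
    IsMatched (matchingAfter y (P ++ [p])) w := by
  classical
  by_cases hp : IsMatched (matchingAfter y P) (Sum.inl p)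
  · rw [matchingAfter_concat_of_isMatched y hp]
    rcases hw with rfl | hw
    · exact hp
    · exact hw
  · obtain ⟨u, -, -, -, hM⟩ := exists_matchingAfter_concat y hpP hp
    rw [hM, isMatched_insert]
    tauto

/-- The pendant is always available at the deadline of its group vertex, so no group vertex expires
unmatched. -/
theorem isMatched_matchingAfter_of_mem (y : LayeredVertex k h → ℝ) {P : List (Fin h × Fin k)}
    (hP : P.Nodup) {p : Fin h × Fin k} (hp : p ∈ P) :
    IsMatched (matchingAfter y P) (Sum.inl p) := by
  induction P using List.reverseRecOn with
  | nil => simp at hp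
  | append_singleton P q ih =>
    rw [List.nodup_append] at hP
    have hq : q ∉ P := fun hq => hP.2.2 q hq q (by simp) rfl
    refine isMatched_matchingAfter_concat y hq ?_
    simp only [List.mem_append, List.mem_singleton] at hp
    rcases hp with hp | rfl
    · exact Or.inr (ih hP.1 hp)
    · exact Or.inl rfl

open Classical in
theorem card_filter_isMatched_matchingAfter (y : LayeredVertex k h → ℝ)
    {P : List (Fin h × Fin k)} (hP : P.Nodup) :
    (Finset.univ.filter fun w => IsMatched (matchingAfter y P) w).card =
      2 * (matchingAfter y P).card := by
  induction P using List.reverseRecOn with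
  | nil => simp [not_isMatched_empty]
  | append_singleton P p ih =>
    rw [List.nodup_append] at hP
    have hpP : p ∉ P := fun hq => hP.2.2 p hq p (by simp) rfl
    have ih := ih hP.1
    by_cases hp : IsMatched (matchingAfter y P) (Sum.inl p)
    · rwa [matchingAfter_concat_of_isMatched y hp]
    · obtain ⟨u, hu, hu', -, hM⟩ := exists_matchingAfter_concat y hpP hp
      rw [hM, card_filter_isMatched_insert hu.ne hp hu', card_insert_of_not_isMatched hp, ih]
      ring

/-! ### The order of the deadlines, and the run as a fold over group vertices. -/

/-- The group vertices whose deadlines come before that of the `a`-th vertex of group `i`. -/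
def indicesBefore (k h : ℕ) (i : Fin h) (a : ℕ) : List (Fin h × Fin k) :=
  ((List.finRange h).take i).product (List.finRange k) ++
    ((List.finRange k).take a).map (fun b => (i, b))

/-- The vertices of the groups before group `i`. -/
def groupsBefore (k h i : ℕ) : List (Fin h × Fin k) :=
  ((List.finRange h).take i).product (List.finRange k)

theorem mem_take_finRange {n m : ℕ} (x : Fin n) : x ∈ (List.finRange n).take m ↔ (x : ℕ) < m := by
  rw [List.mem_take_iff_getElem]
  constructor
  · rintro ⟨j, hj, rfl⟩
    simp only [List.getElem_finRange, Fin.val_cast]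
    omega
  · intro hx
    exact ⟨x, by simp [hx], by simp⟩

theorem mem_product' {α β : Type*} {l₁ : List α} {l₂ : List β} {p : α × β} :
    p ∈ l₁.product l₂ ↔ p.1 ∈ l₁ ∧ p.2 ∈ l₂ :=
  List.mem_product

theorem groupsBefore_self (k h : ℕ) : groupsBefore k h h = layeredIndices k h := by
  rw [groupsBefore, layeredIndices, List.take_of_length_le (by simp)]

theorem groupsBefore_zero (k h : ℕ) : groupsBefore k h 0 = [] := rfl

theorem indicesBefore_zero (k : ℕ) {h : ℕ} (i : Fin h) :
    indicesBefore k h i 0 = groupsBefore k h i := by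
  simp [indicesBefore, groupsBefore]

theorem take_finRange_succ {n m : ℕ} (hm : m < n) :
    (List.finRange n).take (m + 1) = (List.finRange n).take m ++ [⟨m, hm⟩] := by
  rw [List.take_succ_eq_append_getElem (by simpa)]
  simp

theorem indicesBefore_self (k : ℕ) {h : ℕ} (i : Fin h) :
    indicesBefore k h i k = groupsBefore k h (i + 1) := by
  rw [indicesBefore, groupsBefore, take_finRange_succ i.2,
    List.take_of_length_le (l := List.finRange k) (by simp)]
  simp [List.product]

theorem indicesBefore_succ {k h : ℕ} (i : Fin h) {a : ℕ} (ha : a < k) :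
    indicesBefore k h i (a + 1) = indicesBefore k h i a ++ [(i, ⟨a, ha⟩)] := by
  rw [indicesBefore, take_finRange_succ ha]
  simp [indicesBefore]

theorem mem_indicesBefore {i : Fin h} {a : ℕ} {p : Fin h × Fin k} :
    p ∈ indicesBefore k h i a ↔ p.1 < i ∨ p.1 = i ∧ (p.2 : ℕ) < a := by
  obtain ⟨j, b⟩ := p
  have : (j, b) ∈ ((List.finRange h).take i).product (List.finRange k) ↔ j < i := by
    rw [mem_product', mem_take_finRange]
    simp
  rw [indicesBefore, List.mem_append, this]
  simp only [List.mem_map, mem_take_finRange, Prod.mk.injEq]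
  constructor
  · rintro (hj | ⟨c, hc, rfl, rfl⟩)
    · exact Or.inl hj
    · exact Or.inr ⟨rfl, hc⟩
  · rintro (hj | ⟨rfl, hb⟩)
    · exact Or.inl hj
    · exact Or.inr ⟨b, hb, rfl, rfl⟩

theorem nodup_indicesBefore (i : Fin h) (a : ℕ) : (indicesBefore k h i a).Nodup := by
  refine List.Nodup.append ?_ ?_ ?_
  · exact ((List.nodup_finRange h).sublist (List.take_sublist _ _)).product (List.nodup_finRange k)
  · exact ((List.nodup_finRange k).sublist (List.take_sublist _ _)).map
      fun b c hbc => (Prod.mk.inj hbc).2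
  · rintro ⟨j, b⟩ hx hy
    rw [mem_product', mem_take_finRange] at hx
    simp only [List.mem_map, Prod.mk.injEq] at hy
    obtain ⟨c, -, rfl, -⟩ := hy
    exact absurd hx.1 (lt_irrefl _)

theorem not_mem_indicesBefore_self (i : Fin h) {a : ℕ} (ha : a < k) :
    (i, (⟨a, ha⟩ : Fin k)) ∉ indicesBefore k h i a := by
  simp [mem_indicesBefore]

/-- The matching before the deadline of the `a`-th vertex of group `i`. -/
noncomputable def matchingBefore (y : LayeredVertex k h → ℝ) (i : Fin h) (a : ℕ) :
    Finset (Sym2 (LayeredVertex k h)) :=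
  matchingAfter y (indicesBefore k h i a)

theorem foldl_arrival {V : Type*} [Fintype V] (G : SimpleGraph V) (y : V → ℝ) (L : List V)
    (M : Finset (Sym2 V)) : (L.map Event.arrival).foldl (rankingStep G y) M = M := by
  induction L with
  | nil => rfl
  | cons v L ih => simpa [rankingStep] using ih

theorem foldl_deadline_inl (y : LayeredVertex k h → ℝ) (P : List (Fin h × Fin k)) :
    ((P.map Sum.inl).map Event.deadline).foldl (rankingStep (layeredGraph k h) y) ∅ =
      matchingAfter y P := by
  rw [List.map_map, List.foldl_map]
  rfl

/-- Pendants have only group vertices as neighbours; once all of these are matched, the pendant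
deadlines do nothing. -/
theorem foldl_deadline_inr (y : LayeredVertex k h → ℝ) {M : Finset (Sym2 (LayeredVertex k h))}
    (hM : ∀ p, IsMatched M (Sum.inl p)) (P : List (Fin h × Fin k)) :
    ((P.map Sum.inr).map Event.deadline).foldl (rankingStep (layeredGraph k h) y) M = M := by
  induction P with
  | nil => rfl
  | cons p P ih =>
    simp only [List.map_cons, List.foldl_cons]
    rw [rankingStep_deadline_of_forall_isMatched, ih]
    rintro (q | q) hq
    · exact hM q
    · exact absurd hq layeredGraph_adj_inr_inr

theorem nodup_layeredIndices (k h : ℕ) : (layeredIndices k h).Nodup :=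
  (List.nodup_finRange h).product (List.nodup_finRange k)

theorem mem_layeredIndices (p : Fin h × Fin k) : p ∈ layeredIndices k h := by
  simp [layeredIndices, mem_product']

theorem ranking_layeredInstance (y : LayeredVertex k h → ℝ) :
    ranking (layeredInstance k h) y = matchingAfter y (layeredIndices k h) := by
  have hM : ∀ p, IsMatched (matchingAfter y (layeredIndices k h)) (Sum.inl p) := fun p =>
    isMatched_matchingAfter_of_mem y (nodup_layeredIndices k h) (mem_layeredIndices p)
  simp only [ranking, layeredInstance, List.foldl_append, foldl_arrival, layeredVertices,
    List.map_append]
  rw [foldl_deadline_inl, foldl_deadline_inr y hM]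

theorem takeWhile_append_cons {α : Type*} (p : α → Bool) (l₁ l₂ : List α) (e : α)
    (h₁ : ∀ a ∈ l₁, p a = true) (he : p e = false) : (l₁ ++ e :: l₂).takeWhile p = l₁ := by
  rw [List.takeWhile_append_of_pos h₁, List.takeWhile_cons_of_neg (by simp [he]), List.append_nil]

theorem exists_layeredIndices_eq (hk : 0 < k) (i : Fin h) :
    ∃ l, layeredIndices k h = groupsBefore k h i ++ (i, ⟨0, hk⟩) :: l := by
  obtain ⟨k, rfl⟩ : ∃ m, k = m + 1 := ⟨k - 1, by omega⟩
  have hsplit : List.finRange h =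
      (List.finRange h).take i ++ i :: (List.finRange h).drop (i + 1) := by
    conv_lhs => rw [← List.take_append_drop i (List.finRange h)]
    rw [List.drop_eq_getElem_cons (by simp)]
    simp
  refine ⟨(List.finRange k).map (fun b => (i, b.succ)) ++
    ((List.finRange h).drop (i + 1)).product (List.finRange (k + 1)), ?_⟩
  rw [layeredIndices]
  conv_lhs => rw [hsplit]
  simp [groupsBefore, List.product, List.finRange_succ, List.map_map, Function.comp_def]

theorem rankingBefore_layeredInstance (hk : 0 < k) (i : Fin h) (y : LayeredVertex k h → ℝ) :
    rankingBefore (layeredInstance k h) y (Event.deadline (Sum.inl (i, ⟨0, hk⟩))) =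
      matchingBefore y i 0 := by
  obtain ⟨l, hl⟩ := exists_layeredIndices_eq hk i
  have hev : (layeredInstance k h).events =
      ((layeredVertices k h).map Event.arrival ++
        ((groupsBefore k h i).map Sum.inl).map Event.deadline) ++
      Event.deadline (Sum.inl (i, ⟨0, hk⟩)) ::
        ((l.map Sum.inl).map Event.deadline ++
          ((layeredIndices k h).map Sum.inr).map Event.deadline) := by
    simp only [layeredInstance, layeredVertices, List.map_append, List.append_assoc]
    congr 1
    conv_lhs => rw [hl]
    rw [hl]
    simp
  rw [rankingBefore, hev, takeWhile_append_cons, List.foldl_append, foldl_arrival]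
  · rw [matchingBefore, indicesBefore_zero, ← foldl_deadline_inl]
    rfl
  · intro e he
    simp only [List.mem_append, List.mem_map] at he
    rcases he with ⟨v, -, rfl⟩ | ⟨_, ⟨q, hq, rfl⟩, rfl⟩
    · simp
    · rw [← indicesBefore_zero] at hq
      have := not_mem_indicesBefore_self i hk
      simp only [ne_eq, Event.deadline.injEq, Sum.inl.injEq, decide_not, Bool.not_eq_eq_eq_not,
        Bool.not_true, decide_eq_false_iff_not]
      rintro rfl
      exact this hq
  · simp

/-! ### Counting unmatched vertices group by group. -/

open Classical in
/-- The number of vertices of group `j` that are not covered by `M`. -/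
noncomputable def unmatchedCount (M : Finset (Sym2 (LayeredVertex k h))) (j : ℕ) : ℕ :=
  (Finset.univ.filter fun p : Fin h × Fin k => (p.1 : ℕ) = j ∧ ¬ IsMatched M (Sum.inl p)).card

open Classical in
/-- The number of vertices of group `j` of rank at most `x`. -/
noncomputable def rankCount (y : LayeredVertex k h → ℝ) (j : ℕ) (x : ℝ) : ℕ :=
  (Finset.univ.filter fun p : Fin h × Fin k => (p.1 : ℕ) = j ∧ y (Sum.inl p) ≤ x).card

open Classical in
theorem card_group {j : ℕ} (hj : j < h) :
    (Finset.univ.filter fun p : Fin h × Fin k => (p.1 : ℕ) = j).card = k := by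
  have : (Finset.univ.filter fun p : Fin h × Fin k => (p.1 : ℕ) = j) =
      {(⟨j, hj⟩ : Fin h)} ×ˢ Finset.univ := by
    ext p
    simp only [Finset.mem_filter, Finset.mem_univ, true_and, Finset.mem_product,
      Finset.mem_singleton, Fin.ext_iff, and_true]
  rw [this]
  simp

open Classical in
theorem card_matched_group (M : Finset (Sym2 (LayeredVertex k h))) {j : ℕ} (hj : j < h) :
    (Finset.univ.filter fun p : Fin h × Fin k =>
      (p.1 : ℕ) = j ∧ IsMatched M (Sum.inl p)).card + unmatchedCount M j = k := by
  rw [unmatchedCount, ← Finset.filter_filter, ← Finset.filter_filter,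
    Finset.card_filter_add_card_filter_not, card_group hj]

theorem unmatchedCount_le (M : Finset (Sym2 (LayeredVertex k h))) (j : ℕ) :
    unmatchedCount M j ≤ k := by
  classical
  by_cases hj : j < h
  · have := card_matched_group M hj
    omega
  · rw [unmatchedCount, Finset.card_eq_zero.2]
    · exact Nat.zero_le _
    · ext p
      simp
      omega

theorem unmatchedCount_insert_of_ne [DecidableEq (LayeredVertex k h)]
    {M : Finset (Sym2 (LayeredVertex k h))} {u v : LayeredVertex k h} {j : ℕ}
    (hu : ∀ p : Fin h × Fin k, (p.1 : ℕ) = j → u ≠ Sum.inl p)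
    (hv : ∀ p : Fin h × Fin k, (p.1 : ℕ) = j → v ≠ Sum.inl p) :
    unmatchedCount (insert s(u, v) M) j = unmatchedCount M j := by
  unfold unmatchedCount
  congr 1
  ext p
  simp only [isMatched_insert, Finset.mem_filter, Finset.mem_univ, true_and]
  refine and_congr_right fun hp => ?_
  simp [(hu p hp).symm, (hv p hp).symm]

theorem unmatchedCount_insert_left [DecidableEq (LayeredVertex k h)]
    {M : Finset (Sym2 (LayeredVertex k h))} {q : Fin h × Fin k} {v : LayeredVertex k h}
    (hq : ¬ IsMatched M (Sum.inl q))
    (hv : ∀ p : Fin h × Fin k, (p.1 : ℕ) = q.1 → v ≠ Sum.inl p) :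
    unmatchedCount (insert s(Sum.inl q, v) M) q.1 + 1 = unmatchedCount M q.1 := by
  classical
  unfold unmatchedCount
  have hmem : q ∈ Finset.univ.filter
      fun p : Fin h × Fin k => (p.1 : ℕ) = q.1 ∧ ¬ IsMatched M (Sum.inl p) := by simp [hq]
  rw [← Finset.card_erase_add_one hmem]
  congr 2
  ext p
  simp only [isMatched_insert, Finset.mem_filter, Finset.mem_univ, true_and, Finset.mem_erase,
    Sum.inl.injEq, not_or]
  constructor
  · rintro ⟨h1, h2, -, h3⟩
    exact ⟨h2, h1, h3⟩
  · rintro ⟨h1, h2, h3⟩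
    exact ⟨h2, h1, (hv p h2).symm, h3⟩

theorem unmatchedCount_insert_right [DecidableEq (LayeredVertex k h)]
    {M : Finset (Sym2 (LayeredVertex k h))} {q : Fin h × Fin k} {v : LayeredVertex k h}
    (hq : ¬ IsMatched M (Sum.inl q))
    (hv : ∀ p : Fin h × Fin k, (p.1 : ℕ) = q.1 → v ≠ Sum.inl p) :
    unmatchedCount (insert s(v, Sum.inl q) M) q.1 + 1 = unmatchedCount M q.1 := by
  rw [Sym2.eq_swap, unmatchedCount_insert_left hq hv]

theorem not_isMatched_matchingBefore_zero (y : LayeredVertex k h → ℝ) {i : Fin h}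
    {p : Fin h × Fin k} (hp : (i : ℕ) < p.1) :
    ¬ IsMatched (matchingBefore y i 0) (Sum.inl p) := by
  intro hM
  obtain ⟨q, hq, hpq⟩ := exists_of_isMatched_inl y _ hM
  rw [mem_indicesBefore, Fin.lt_def, Fin.ext_iff] at hq
  omega

theorem isMatched_matchingBefore (y : LayeredVertex k h → ℝ) {i : Fin h} {a : ℕ}
    {p : Fin h × Fin k} (hp : p.1 < i ∨ p.1 = i ∧ (p.2 : ℕ) < a) :
    IsMatched (matchingBefore y i a) (Sum.inl p) :=
  isMatched_matchingAfter_of_mem y (nodup_indicesBefore i a) (mem_indicesBefore.2 hp)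

theorem not_isMatched_inr_matchingBefore (y : LayeredVertex k h → ℝ) (i : Fin h) {a : ℕ}
    (ha : a < k) : ¬ IsMatched (matchingBefore y i a) (Sum.inr (i, ⟨a, ha⟩)) := fun hM =>
  not_mem_indicesBefore_self i ha (mem_of_isMatched_inr y _ hM)

theorem matchingBefore_succ_of_isMatched (y : LayeredVertex k h → ℝ) (i : Fin h) {a : ℕ}
    (ha : a < k) (hM : IsMatched (matchingBefore y i a) (Sum.inl (i, ⟨a, ha⟩))) :
    matchingBefore y i (a + 1) = matchingBefore y i a := by
  unfold matchingBefore
  rw [indicesBefore_succ i ha]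
  exact matchingAfter_concat_of_isMatched y hM

/-- At its deadline, an unmatched group vertex is matched to its pendant vertex or to a vertex of
smallest rank among the unmatched vertices of the next group. -/
theorem exists_matchingBefore_succ [DecidableEq (LayeredVertex k h)] (y : LayeredVertex k h → ℝ)
    (i : Fin h) {a : ℕ} (ha : a < k)
    (hM : ¬ IsMatched (matchingBefore y i a) (Sum.inl (i, ⟨a, ha⟩))) :
    ∃ u, (u = Sum.inr (i, ⟨a, ha⟩) ∨ ∃ p : Fin h × Fin k, (p.1 : ℕ) = i + 1 ∧ u = Sum.inl p) ∧
      ¬ IsMatched (matchingBefore y i a) u ∧ y u ≤ y (Sum.inr (i, ⟨a, ha⟩)) ∧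
      (∀ p : Fin h × Fin k, (p.1 : ℕ) = i + 1 → ¬ IsMatched (matchingBefore y i a) (Sum.inl p) →
        y u ≤ y (Sum.inl p)) ∧
      matchingBefore y i (a + 1) =
        insert s(Sum.inl (i, ⟨a, ha⟩), u) (matchingBefore y i a) := by
  obtain ⟨u, h1, h2, h3, h4⟩ := exists_matchingAfter_concat y (not_mem_indicesBefore_self i ha) hM
  refine ⟨u, ?_, h2, h3 _ rfl (not_isMatched_inr_matchingBefore y i ha), fun p hp => h3 _ ?_, ?_⟩
  · rcases u with p | p
    · refine Or.inr ⟨p, ?_, rfl⟩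
      rw [layeredGraph_adj_inl_inl] at h1
      rcases h1 with h1 | h1
      · exact h1.symm
      -- A neighbour in the previous group has passed its deadline, so it is matched and cannot be
      -- `u`.
      · refine absurd (isMatched_matchingBefore y (Or.inl ?_)) h2
        rw [Fin.lt_def]
        change (p.1 : ℕ) + 1 = i at h1
        omega
    · exact Or.inl (congrArg Sum.inr (layeredGraph_adj_inl_inr.1 h1).symm)
  · exact layeredGraph_adj_inl_inl.2 (Or.inl hp.symm)
  · rw [matchingBefore, indicesBefore_succ i ha, h4]
    rfl

theorem card_matchingBefore_succ (y : LayeredVertex k h → ℝ) (i : Fin h) {a : ℕ} (ha : a < k)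
    (hM : ¬ IsMatched (matchingBefore y i a) (Sum.inl (i, ⟨a, ha⟩))) :
    (matchingBefore y i (a + 1)).card = (matchingBefore y i a).card + 1 := by
  classical
  obtain ⟨u, -, -, -, -, hs⟩ := exists_matchingBefore_succ y i ha hM
  rw [hs, card_insert_of_not_isMatched hM]

theorem unmatchedCount_matchingBefore_succ (y : LayeredVertex k h → ℝ) (i : Fin h) {a : ℕ}
    (ha : a < k) (hM : ¬ IsMatched (matchingBefore y i a) (Sum.inl (i, ⟨a, ha⟩))) :
    unmatchedCount (matchingBefore y i (a + 1)) i + 1 = unmatchedCount (matchingBefore y i a) i := by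
  classical
  obtain ⟨u, hu, -, -, -, hs⟩ := exists_matchingBefore_succ y i ha hM
  rw [hs]
  refine unmatchedCount_insert_left hM fun p hp => ?_
  change (p.1 : ℕ) = i at hp
  rcases hu with rfl | ⟨q, hq, rfl⟩
  · simp
  · intro hqp
    rw [Sum.inl_injective hqp] at hq
    omega

/-- Each edge added during these deadlines covers exactly one vertex of group `i`: its other end is
a pendant or lies in group `i + 1`. -/
theorem card_add_unmatchedCount (y : LayeredVertex k h → ℝ) (i : Fin h) {a : ℕ} (ha : a ≤ k) :
    (matchingBefore y i a).card + unmatchedCount (matchingBefore y i a) i =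
      (matchingBefore y i 0).card + unmatchedCount (matchingBefore y i 0) i := by
  induction a with
  | zero => rfl
  | succ a ih =>
    rw [← ih (by omega)]
    by_cases hM : IsMatched (matchingBefore y i a) (Sum.inl (i, ⟨a, ha⟩))
    · rw [matchingBefore_succ_of_isMatched y i ha hM]
    · have h1 := card_matchingBefore_succ y i ha hM
      have h2 := unmatchedCount_matchingBefore_succ y i ha hM
      omega

/-- The number of vertices of group `i` still unmatched at its first deadline equals the number of edges added during the deadlines of the group. -/
theorem card_matchingBefore_self (y : LayeredVertex k h → ℝ) (i : Fin h) :
    (matchingBefore y i k).card =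
      (matchingBefore y i 0).card + unmatchedCount (matchingBefore y i 0) i := by
  classical
  have : unmatchedCount (matchingBefore y i k) i = 0 := by
    rw [unmatchedCount, Finset.card_eq_zero]
    ext p
    simp only [Finset.mem_filter, Finset.mem_univ, true_and, Finset.notMem_empty, iff_false,
      not_and, not_not]
    exact fun hp => isMatched_matchingBefore y (Or.inr ⟨Fin.ext hp, p.2.2⟩)
  rw [← card_add_unmatchedCount y i le_rfl, this, add_zero]

theorem card_matchingAfter_groupsBefore (y : LayeredVertex k h → ℝ) {m : ℕ} (hm : m ≤ h) :
    (matchingAfter y (groupsBefore k h m)).card =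
      ∑ j ∈ Finset.range m, unmatchedCount (matchingAfter y (groupsBefore k h j)) j := by
  induction m with
  | zero => rfl
  | succ m ih =>
    have := card_matchingBefore_self y (⟨m, hm⟩ : Fin h)
    rw [matchingBefore, matchingBefore, indicesBefore_self, indicesBefore_zero] at this
    rw [Finset.sum_range_succ, ← ih (by omega)]
    exact this

theorem card_ranking_layeredInstance (y : LayeredVertex k h → ℝ) :
    (ranking (layeredInstance k h) y).card =
      ∑ j ∈ Finset.range h, unmatchedCount (matchingAfter y (groupsBefore k h j)) j := by
  rw [ranking_layeredInstance, ← groupsBefore_self, card_matchingAfter_groupsBefore y le_rfl]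

/-- Both sides count covered vertices: all `k * h` group vertices are covered, and each edge covers
two vertices. -/
theorem matchedPendants_add (y : LayeredVertex k h → ℝ) :
    k * h + matchedPendants k h y = 2 * (ranking (layeredInstance k h) y).card := by
  classical
  rw [matchedPendants, ranking_layeredInstance,
    ← card_filter_isMatched_matchingAfter y (nodup_layeredIndices k h)]
  have hl (p : Fin h × Fin k) :
      IsMatched (matchingAfter y (layeredIndices k h)) (Sum.inl p) :=
    isMatched_matchingAfter_of_mem y (nodup_layeredIndices k h) (mem_layeredIndices p)
  rw [Finset.card_filter, Finset.card_filter, Fintype.sum_sum_type]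
  simp [hl, mul_comm]

theorem unmatchedCount_matchingBefore_zero (y : LayeredVertex k h → ℝ) (i : Fin h)
    (hi : (i : ℕ) + 1 < h) :
    unmatchedCount (matchingBefore y i 0) (i + 1) = k := by
  classical
  rw [unmatchedCount]
  conv_rhs => rw [← card_group (k := k) hi]
  congr 1
  ext p
  simp only [Finset.mem_filter, Finset.mem_univ, true_and, and_iff_left_iff_imp]
  exact fun hp => not_isMatched_matchingBefore_zero y (by omega)

theorem unmatchedCount_groupsBefore_zero (y : LayeredVertex k h → ℝ) (hh : 0 < h) :
    unmatchedCount (matchingAfter y (groupsBefore k h 0)) 0 = k := by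
  classical
  rw [unmatchedCount]
  conv_rhs => rw [← card_group (k := k) hh]
  simp [groupsBefore_zero, not_isMatched_empty]

/-- The matched vertices of the next group are those of smallest rank. -/
theorem le_of_isMatched_matchingBefore (y : LayeredVertex k h → ℝ) (i : Fin h) {a : ℕ}
    (ha : a ≤ k) {p q : Fin h × Fin k} (hp : (p.1 : ℕ) = i + 1) (hq : (q.1 : ℕ) = i + 1)
    (hpM : IsMatched (matchingBefore y i a) (Sum.inl p))
    (hqM : ¬ IsMatched (matchingBefore y i a) (Sum.inl q)) : y (Sum.inl p) ≤ y (Sum.inl q) := by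
  classical
  induction a with
  | zero => exact absurd hpM (not_isMatched_matchingBefore_zero y (by omega))
  | succ a ih =>
    by_cases hM : IsMatched (matchingBefore y i a) (Sum.inl (i, ⟨a, ha⟩))
    · rw [matchingBefore_succ_of_isMatched y i ha hM] at hpM hqM
      exact ih (by omega) hpM hqM
    · obtain ⟨u, -, -, -, hmin, hs⟩ := exists_matchingBefore_succ y i ha hM
      rw [hs, isMatched_insert] at hpM hqM
      push Not at hqM
      rcases hpM with hpM | rfl | hpM
      · rw [Sum.inl_injective hpM] at hp
        simp at hp
      · exact hmin q hq hqM.2.2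
      · exact ih (by omega) hpM hqM.2.2

/-- With `U` vertices of the next group unmatched, the `k - U` matched ones have the smallest ranks.
The best free vertex therefore beats the pendant exactly when more than `k - U` ranks of that group
are at most the pendant's rank. Injectivity excludes a tie with the pendant. -/
theorem unmatchedCount_next_matchingBefore_succ {y : LayeredVertex k h → ℝ}
    (hy : Function.Injective y) (i : Fin h) (hi : (i : ℕ) + 1 < h) {a : ℕ} (ha : a < k)
    (hM : ¬ IsMatched (matchingBefore y i a) (Sum.inl (i, ⟨a, ha⟩))) :
    unmatchedCount (matchingBefore y i (a + 1)) (i + 1) +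
      (if k < rankCount y (i + 1) (y (Sum.inr (i, ⟨a, ha⟩))) +
        unmatchedCount (matchingBefore y i a) (i + 1) then 1 else 0) =
      unmatchedCount (matchingBefore y i a) (i + 1) := by
  classical
  obtain ⟨u, hu, huM, hle, hmin, hs⟩ := exists_matchingBefore_succ y i ha hM
  have hcard := card_matched_group (matchingBefore y i a) hi
  rw [hs]
  rcases hu with rfl | ⟨p, hp, rfl⟩
  · rw [if_neg, unmatchedCount_insert_of_ne, add_zero]
    · rintro p hp hip
      rw [← Sum.inl_injective hip] at hp
      simp at hp
    · simp
    -- The pendant was chosen: every vertex of the next group ranked at most as high is already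
    -- matched.
    · have : rankCount y (i + 1) (y (Sum.inr (i, ⟨a, ha⟩))) ≤
          (Finset.univ.filter fun p : Fin h × Fin k =>
            (p.1 : ℕ) = i + 1 ∧ IsMatched (matchingBefore y i a) (Sum.inl p)).card := by
        refine Finset.card_le_card fun p => ?_
        simp only [Finset.mem_filter, Finset.mem_univ, true_and]
        rintro ⟨hp, hpy⟩
        refine ⟨hp, ?_⟩
        by_contra hpM
        exact absurd (hy (le_antisymm hpy (hmin p hp hpM))) (by simp)
      omega
  -- The vertex `p` was chosen: all matched vertices, and also the unmatched `p`, rank at most as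
  -- high as the pendant.
  · have hlt : (Finset.univ.filter fun p : Fin h × Fin k =>
        (p.1 : ℕ) = i + 1 ∧ IsMatched (matchingBefore y i a) (Sum.inl p)).card <
          rankCount y (i + 1) (y (Sum.inr (i, ⟨a, ha⟩))) := by
      refine Finset.card_lt_card ⟨fun q => ?_, fun hsub => ?_⟩
      · simp only [Finset.mem_filter, Finset.mem_univ, true_and]
        rintro ⟨hq, hqM⟩
        exact ⟨hq, (le_of_isMatched_matchingBefore y i ha.le hq hp hqM huM).trans hle⟩
      · have := @hsub p (by simp [hp, hle])
        simp only [Finset.mem_filter] at this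
        exact huM this.2.2
    rw [if_pos (by omega), ← hp]
    refine unmatchedCount_insert_right huM fun q hq hiq => ?_
    rw [← Sum.inl_injective hiq] at hq
    simp only at hq
    omega

theorem unmatchedInGroup_eq (hk : 0 < k) (i : Fin h) (y : LayeredVertex k h → ℝ) :
    unmatchedInGroup k h hk i y = unmatchedCount (matchingBefore y i 0) i := by
  classical
  rw [unmatchedInGroup, rankingBefore_layeredInstance, unmatchedCount]
  have : (Finset.univ.filter fun p : Fin h × Fin k =>
      (p.1 : ℕ) = i ∧ ¬ IsMatched (matchingBefore y i 0) (Sum.inl p)) =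
      (Finset.univ.filter fun a : Fin k =>
        ¬ IsMatched (matchingBefore y i 0) (Sum.inl (i, a))).map
          ⟨fun a => (i, a), fun a b hab => (Prod.mk.inj hab).2⟩ := by
    ext ⟨j, b⟩
    simp only [Finset.mem_filter, Finset.mem_univ, true_and, Finset.mem_map]
    constructor
    · rintro ⟨hj, hM⟩
      obtain rfl := Fin.ext hj
      exact ⟨b, hM, rfl⟩
    · rintro ⟨c, hM, hc⟩
      obtain ⟨rfl, rfl⟩ := Prod.mk.inj hc
      exact ⟨rfl, hM⟩
  rw [this, Finset.card_map]

end Layered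

/-! ### The law of the ranks: order-invariant functions and redrawing one rank. -/

/-- `f y` depends only on the relative order of the ranks `y`. -/
def OrderInvariant {V β : Type*} (f : (V → ℝ) → β) : Prop :=
  ∀ y y' : V → ℝ, (∀ u v, y u < y v ↔ y' u < y' v) → f y = f y'

theorem OrderInvariant.comp {V β γ : Type*} {f : (V → ℝ) → β} (hf : OrderInvariant f) (g : β → γ) :
    OrderInvariant fun y => g (f y) := fun y y' hy => congrArg g (hf y y' hy)

section RankLaw

/-- The uniform distribution on `[0, 1)`. -/
noncomputable abbrev uniformLaw : Measure ℝ := (volume : Measure ℝ).restrict (Set.Ico 0 1)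

instance isProbabilityMeasure_uniformLaw : IsProbabilityMeasure uniformLaw :=
  ⟨by simp [uniformLaw]⟩

variable {V : Type*} [Fintype V]

instance isProbabilityMeasure_rankLaw : IsProbabilityMeasure (rankLaw V) := by
  unfold rankLaw
  infer_instance

/-- Overwriting one coordinate by a fresh uniform rank preserves the law. Independence of a
pendant's rank from the past is used in this form. -/
theorem measurePreserving_update [DecidableEq V] (v : V) :
    MeasurePreserving (fun q : (V → ℝ) × ℝ => Function.update q.1 v q.2)
      ((rankLaw V).prod uniformLaw) (rankLaw V) := by
  have hmeas : Measurable fun q : (V → ℝ) × ℝ => Function.update q.1 v q.2 := by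
    refine measurable_pi_lambda _ fun u => ?_
    by_cases huv : u = v
    · subst huv
      simpa using measurable_snd
    · simp only [Function.update_of_ne huv]
      exact (measurable_pi_apply u).comp measurable_fst
  refine ⟨hmeas, ?_⟩
  symm
  refine Measure.pi_eq fun s hs => ?_
  rw [Measure.map_apply hmeas (MeasurableSet.univ_pi hs)]
  have : (fun q : (V → ℝ) × ℝ => Function.update q.1 v q.2) ⁻¹' Set.univ.pi s =
      (Set.univ.pi (Function.update s v Set.univ)) ×ˢ s v := by
    ext ⟨y, x⟩
    simp only [Set.mem_preimage, Set.mem_pi, Set.mem_univ, true_imp_iff, Set.mem_prod]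
    constructor
    · refine fun hy => ⟨fun u => ?_, by simpa using hy v⟩
      by_cases huv : u = v
      · subst huv
        simp
      · simpa [Function.update_of_ne huv] using hy u
    · rintro ⟨hy, hx⟩ u
      by_cases huv : u = v
      · subst huv
        simpa using hx
      · simpa [Function.update_of_ne huv] using hy u
  rw [this, Measure.prod_prod, rankLaw, Measure.pi_pi,
    ← Finset.mul_prod_erase Finset.univ (fun u => uniformLaw (s u)) (Finset.mem_univ v),
    ← Finset.mul_prod_erase Finset.univ _ (Finset.mem_univ v)]
  rw [Function.update_self, measure_univ, one_mul, mul_comm]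
  congr 1
  refine Finset.prod_congr rfl fun u hu => ?_
  rw [Function.update_of_ne (Finset.ne_of_mem_erase hu)]

theorem integral_rankLaw_eq_integral_update [DecidableEq V] (v : V) {f : (V → ℝ) → ℝ}
    (hf : Integrable f (rankLaw V)) :
    ∫ y, f y ∂(rankLaw V) = ∫ y, ∫ x, f (Function.update y v x) ∂uniformLaw ∂(rankLaw V) := by
  have hmp := measurePreserving_update v
  conv_lhs => rw [← hmp.map_eq]
  rw [integral_map hmp.measurable.aemeasurable (by rw [hmp.map_eq]; exact hf.1)]
  exact integral_prod _ ((hmp.integrable_comp hf.1).2 hf)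

theorem integrable_integral_update [DecidableEq V] (v : V) {f : (V → ℝ) → ℝ}
    (hf : Integrable f (rankLaw V)) :
    Integrable (fun y => ∫ x, f (Function.update y v x) ∂uniformLaw) (rankLaw V) :=
  Integrable.integral_prod_left
    (((measurePreserving_update v).integrable_comp hf.1).2 hf)

/-- Once `y v` is redrawn with the rest fixed, a tie with `y u` forces it to be a single value,
which has measure zero. -/
theorem ae_injective_rankLaw : ∀ᵐ y ∂(rankLaw V), Function.Injective y := by
  classical
  have hne : ∀ u v : V, ∀ᵐ y ∂(rankLaw V), u ≠ v → y u ≠ y v := by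
    intro u v
    by_cases huv : u = v
    · simp [huv]
    have hs : MeasurableSet {y : V → ℝ | y u = y v} :=
      measurableSet_eq_fun (measurable_pi_apply u) (measurable_pi_apply v)
    have hzero : rankLaw V {y : V → ℝ | y u = y v} = 0 := by
      rw [← (measurePreserving_update v).measure_preimage hs.nullMeasurableSet,
        Measure.measure_prod_null ((measurePreserving_update v).measurable hs)]
      refine Eventually.of_forall fun y => ?_
      have : (Prod.mk y ⁻¹' ((fun q : (V → ℝ) × ℝ => Function.update q.1 v q.2) ⁻¹'
          {y : V → ℝ | y u = y v})) = {y u} := by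
        ext x
        simp [Function.update_of_ne huv, eq_comm]
      change uniformLaw (Prod.mk y ⁻¹' _) = 0
      rw [this]
      simp
    refine (measure_eq_zero_iff_ae_notMem.1 hzero).mono fun y hy _ => hy
  have := ae_all_iff.2 fun u => ae_all_iff.2 (hne u)
  filter_upwards [this] with y hy u v huv
  by_contra h
  exact hy u v h huv

/-- Such an `f` factors through the comparison pattern `g`, which is measurable and takes finitely
many values. -/
theorem OrderInvariant.measurable {β : Type*} [MeasurableSpace β] {f : (V → ℝ) → β}
    (hf : OrderInvariant f) : Measurable f := by
  classical
  let g : (V → ℝ) → (V × V → Prop) := fun y q => y q.1 < y q.2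
  have hg : Measurable g := measurable_pi_lambda _ fun q =>
    measurableSet_setOfPred.1 (measurableSet_lt (measurable_pi_apply q.1) (measurable_pi_apply q.2))
  intro t _
  have : f ⁻¹' t = g ⁻¹' (g '' (f ⁻¹' t)) := by
    refine Set.Subset.antisymm (Set.subset_preimage_image _ _) ?_
    rintro y ⟨y', hy', hyy⟩
    have : f y = f y' := hf y y' fun u v => by
      have := congrFun hyy (u, v)
      exact iff_of_eq this.symm
    rwa [Set.mem_preimage, this]
  rw [this]
  exact hg (Set.toFinite _).measurableSet

theorem OrderInvariant.finite_range {β : Type*} {f : (V → ℝ) → β} (hf : OrderInvariant f) :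
    (Set.range f).Finite := by
  classical
  let g : (V → ℝ) → (V × V → Prop) := fun y q => y q.1 < y q.2
  have hfin : (Set.range g).Finite := Set.toFinite _
  have : Set.range f ⊆ (fun p => f (Function.invFun g p)) '' Set.range g := by
    rintro _ ⟨y, rfl⟩
    refine ⟨g y, ⟨y, rfl⟩, hf _ _ fun u v => ?_⟩
    have : g (Function.invFun g (g y)) = g y := Function.invFun_eq ⟨y, rfl⟩
    exact iff_of_eq (congrFun this (u, v))
  exact (hfin.image _).subset this

theorem OrderInvariant.integrable {f : (V → ℝ) → ℝ} (hf : OrderInvariant f) :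
    Integrable f (rankLaw V) := by
  obtain ⟨C, hC⟩ := hf.finite_range.isBounded.exists_norm_le
  exact Integrable.of_bound hf.measurable.aestronglyMeasurable C
    (Eventually.of_forall fun y => hC _ ⟨y, rfl⟩)

end RankLaw

/-! ### Fresh pendant ranks and the empirical distribution of the ranks of a group. -/

section Layered

variable {k h : ℕ}

theorem orderInvariant_matchingAfter (P : List (Fin h × Fin k)) :
    OrderInvariant fun y : LayeredVertex k h → ℝ => matchingAfter y P :=
  fun _ _ hy => matchingAfter_congr P fun _ _ u _ w _ => hy u w

/-- The rank of a pendant is first consulted at the deadline of its own group vertex. -/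
theorem matchingBefore_update (y : LayeredVertex k h → ℝ) (i : Fin h) {a b : ℕ} (ha : a < k)
    (hb : b ≤ a) (x : ℝ) :
    matchingBefore (Function.update y (Sum.inr (i, ⟨a, ha⟩)) x) i b = matchingBefore y i b := by
  refine matchingAfter_congr _ fun p hp => ?_
  have hne : ∀ u, (layeredGraph k h).Adj (Sum.inl p) u → u ≠ Sum.inr (i, ⟨a, ha⟩) := by
    rintro u hu rfl
    rw [layeredGraph_adj_inl_inr] at hu
    subst hu
    rw [mem_indicesBefore] at hp
    simp at hp
    omega
  intro u hu w hw
  rw [Function.update_of_ne (hne u hu), Function.update_of_ne (hne w hw)]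

theorem rankCount_update_inr (y : LayeredVertex k h → ℝ) (j : ℕ) (p : Fin h × Fin k) (x z : ℝ) :
    rankCount (Function.update y (Sum.inr p) x) j z = rankCount y j z := by
  simp [rankCount]

theorem rankCount_mono (y : LayeredVertex k h → ℝ) (j : ℕ) : Monotone (rankCount y j) := by
  classical
  intro x x' hx
  refine Finset.card_le_card fun p => ?_
  simp only [Finset.mem_filter, Finset.mem_univ, true_and]
  exact fun hp => ⟨hp.1, hp.2.trans hx⟩

theorem orderInvariant_rankCount (j : ℕ) (v : LayeredVertex k h) :
    OrderInvariant fun y : LayeredVertex k h → ℝ => rankCount y j (y v) := by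
  intro y y' hy
  simp only [rankCount]
  congr 1
  ext p
  simp only [Finset.mem_filter, Finset.mem_univ, true_and, ← not_lt, hy]

open Classical in
theorem rankCount_eq_sum (y : LayeredVertex k h → ℝ) (j : ℕ) (r : ℝ) :
    (rankCount y j r : ℝ) = ∑ p : Fin h × Fin k with (p.1 : ℕ) = j,
      (Set.Iic r).indicator (fun _ => (1 : ℝ)) (y (Sum.inl p)) := by
  rw [rankCount, ← Finset.filter_filter, Finset.card_filter]
  push_cast
  refine Finset.sum_congr rfl fun p _ => ?_
  simp [Set.indicator_apply]

theorem integral_indicator_rank {r : ℝ} (h0 : 0 ≤ r) (h1 : r ≤ 1) (v : LayeredVertex k h) :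
    ∫ y, (Set.Iic r).indicator (fun _ => (1 : ℝ)) (y v) ∂(rankLaw (LayeredVertex k h)) = r := by
  have hmp : MeasurePreserving (Function.eval v) (rankLaw (LayeredVertex k h)) uniformLaw :=
    measurePreserving_eval (fun _ : LayeredVertex k h => uniformLaw) v
  have hmeas : Measurable ((Set.Iic r).indicator (fun _ : ℝ => (1 : ℝ))) :=
    measurable_const.indicator measurableSet_Iic
  have := integral_map (μ := rankLaw (LayeredVertex k h)) hmp.measurable.aemeasurable
    (f := (Set.Iic r).indicator (fun _ : ℝ => (1 : ℝ))) hmeas.aestronglyMeasurable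
  rw [hmp.map_eq] at this
  refine this.symm.trans ?_
  rw [integral_indicator_const _ measurableSet_Iic, smul_eq_mul, mul_one, measureReal_def,
    Measure.restrict_apply measurableSet_Iic]
  rcases h1.eq_or_lt with rfl | h1
  · have : Set.Iic (1 : ℝ) ∩ Set.Ico 0 1 = Set.Ico 0 1 := by
      ext x
      simp only [Set.mem_inter_iff, Set.mem_Iic, Set.mem_Ico]
      constructor
      · exact fun hx => hx.2
      · exact fun hx => ⟨hx.2.le, hx⟩
    simp [this]
  · have : Set.Iic r ∩ Set.Ico 0 1 = Set.Icc 0 r := by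
      ext x
      simp only [Set.mem_inter_iff, Set.mem_Iic, Set.mem_Ico, Set.mem_Icc]
      constructor
      · exact fun hx => ⟨hx.2.1, hx.1⟩
      · exact fun hx => ⟨hx.2, hx.1, hx.2.trans_lt h1⟩
    simp [this, h0]

/-- A fixed threshold `r` is not order invariant, so measurability is obtained here from the
indicators. -/
theorem integrable_sq_rankCount (j : ℕ) (r : ℝ) :
    Integrable (fun y => ((rankCount y j r : ℝ) / k - r) ^ 2) (rankLaw (LayeredVertex k h)) := by
  classical
  have hmeas : Measurable fun y : LayeredVertex k h → ℝ => (rankCount y j r : ℝ) := by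
    simp_rw [rankCount_eq_sum]
    exact Finset.measurable_fun_sum _ fun p _ =>
      (measurable_const.indicator measurableSet_Iic).comp (measurable_pi_apply _)
  refine Integrable.of_bound (((hmeas.div_const _).sub_const _).pow_const 2).aestronglyMeasurable
    ((((Fintype.card (Fin h × Fin k) : ℕ) : ℝ) / k + |r|) ^ 2) (Eventually.of_forall fun y => ?_)
  rw [norm_pow, Real.norm_eq_abs]
  gcongr
  refine (abs_sub _ _).trans ?_
  gcongr
  rw [abs_of_nonneg (by positivity)]
  gcongr
  exact Finset.card_le_univ _

/-- The count is a sum of `k` independent indicators of mean `r`, each of variance at most 1. -/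
theorem integral_sq_rankCount_le (hk : 0 < k) {j : ℕ} (hj : j < h) {r : ℝ} (h0 : 0 ≤ r)
    (h1 : r ≤ 1) :
    ∫ y, ((rankCount y j r : ℝ) / k - r) ^ 2 ∂(rankLaw (LayeredVertex k h)) ≤ 1 / k := by
  classical
  let s : Finset (Fin h × Fin k) := Finset.univ.filter fun p => (p.1 : ℕ) = j
  have hs : s.card = k := card_group hj
  let X : Fin h × Fin k → (LayeredVertex k h → ℝ) → ℝ := fun p y =>
    (Set.Iic r).indicator (fun _ => (1 : ℝ)) (y (Sum.inl p))
  have hind : Measurable ((Set.Iic r).indicator (fun _ : ℝ => (1 : ℝ))) :=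
    measurable_const.indicator measurableSet_Iic
  have hXm : ∀ p, Measurable (X p) := fun p => hind.comp (measurable_pi_apply _)
  have hX01 : ∀ p y, X p y ∈ Set.Icc (0 : ℝ) 1 := by
    intro p y
    simp only [X, Set.indicator_apply]
    split_ifs <;> simp
  have hXL : ∀ p, MemLp (X p) 2 (rankLaw (LayeredVertex k h)) := fun p =>
    MemLp.of_bound (hXm p).aestronglyMeasurable 1 (Eventually.of_forall fun y => by
      rw [Real.norm_eq_abs, abs_of_nonneg (hX01 p y).1]
      exact (hX01 p y).2)
  have hindep : ProbabilityTheory.iIndepFun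
      (fun (v : LayeredVertex k h) (y : LayeredVertex k h → ℝ) =>
        (Set.Iic r).indicator (fun _ : ℝ => (1 : ℝ)) (y v)) (rankLaw (LayeredVertex k h)) :=
    ProbabilityTheory.iIndepFun_pi (μ := fun _ : LayeredVertex k h => uniformLaw)
      (X := fun _ => (Set.Iic r).indicator (fun _ : ℝ => (1 : ℝ))) fun _ => hind.aemeasurable
  have hvar : ProbabilityTheory.variance (∑ p ∈ s, X p) (rankLaw (LayeredVertex k h)) ≤ k := by
    rw [ProbabilityTheory.IndepFun.variance_sum (fun p _ => hXL p) fun p _ q _ hpq =>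
      hindep.indepFun (fun hh => hpq (Sum.inl_injective hh))]
    calc _ ≤ ∑ _p ∈ s, (1 : ℝ) := Finset.sum_le_sum fun p _ =>
          (ProbabilityTheory.variance_le_sq_of_bounded (Eventually.of_forall (hX01 p))
            (hXm p).aemeasurable).trans (by norm_num)
      _ = k := by simp [hs]
  have hmean : ∫ y, (∑ p ∈ s, X p) y ∂(rankLaw (LayeredVertex k h)) = k * r := by
    simp_rw [Finset.sum_apply]
    rw [integral_finsetSum _ fun p _ => (hXL p).integrable (by norm_num)]
    simp only [X, integral_indicator_rank h0 h1, Finset.sum_const, hs, nsmul_eq_mul]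
  rw [ProbabilityTheory.variance_eq_integral
    (Finset.aemeasurable_sum _ fun p _ => (hXm p).aemeasurable), hmean] at hvar
  have hk' : (0 : ℝ) < k := by exact_mod_cast hk
  calc _ = ∫ y, (1 / (k : ℝ) ^ 2) * ((∑ p ∈ s, X p) y - k * r) ^ 2
        ∂(rankLaw (LayeredVertex k h)) := by
        refine integral_congr_ae (Eventually.of_forall fun y => ?_)
        simp only [rankCount_eq_sum, Finset.sum_apply, X, s]
        field_simp
    _ ≤ (1 / (k : ℝ) ^ 2) * k := by
        rw [integral_const_mul]
        gcongr
    _ = 1 / k := by field_simp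

/-- The sum of the squared deviations of the empirical distribution function of the ranks of
group `j` at the multiples of `1 / n`. -/
noncomputable def gridDeviation (n : ℕ) (y : LayeredVertex k h → ℝ) (j : ℕ) : ℝ :=
  ∑ l ∈ Finset.range (n + 1), ((rankCount y j ((l : ℝ) / n) : ℝ) / k - (l : ℝ) / n) ^ 2

theorem gridDeviation_nonneg (n : ℕ) (y : LayeredVertex k h → ℝ) (j : ℕ) :
    0 ≤ gridDeviation n y j := Finset.sum_nonneg fun _ _ => sq_nonneg _

theorem abs_rankCount_grid_sub_le {n l : ℕ} (y : LayeredVertex k h → ℝ) (j : ℕ) (hl : l ≤ n) :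
    |(rankCount y j ((l : ℝ) / n) : ℝ) / k - (l : ℝ) / n| ≤ √(gridDeviation n y j) := by
  refine Real.abs_le_sqrt ?_
  exact Finset.single_le_sum
    (f := fun l : ℕ => ((rankCount y j ((l : ℝ) / n) : ℝ) / k - (l : ℝ) / n) ^ 2)
    (fun _ _ => sq_nonneg _) (Finset.mem_range.2 (by omega))

/-- The Glivenko–Cantelli argument: by monotonicity the value at `x` lies between those at the
neighbouring grid points, which are `1 / n` apart. -/
theorem abs_rankCount_sub_le {n : ℕ} (hn : 0 < n) (y : LayeredVertex k h → ℝ) (j : ℕ) {x : ℝ}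
    (hx : x ∈ Set.Ico (0 : ℝ) 1) :
    |(rankCount y j x : ℝ) / k - x| ≤ 1 / n + √(gridDeviation n y j) := by
  have hn' : (0 : ℝ) < n := by exact_mod_cast hn
  set l := ⌊(n : ℝ) * x⌋₊ with hl
  have hnx : 0 ≤ (n : ℝ) * x := mul_nonneg hn'.le hx.1
  have h1 : (l : ℝ) ≤ n * x := Nat.floor_le hnx
  have h2 : (n : ℝ) * x < l + 1 := Nat.lt_floor_add_one _
  have hln : l < n := by
    have : (l : ℝ) < n := h1.trans_lt (by nlinarith [hx.2])
    exact_mod_cast this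
  have h1' : (l : ℝ) / n ≤ x := by rw [div_le_iff₀ hn']; linarith
  have h2' : x ≤ ((l + 1 : ℕ) : ℝ) / n := by rw [le_div_iff₀ hn']; push_cast; linarith
  have hsucc : ((l + 1 : ℕ) : ℝ) / n = (l : ℝ) / n + 1 / n := by push_cast; ring
  have g1 := abs_le.1 (abs_rankCount_grid_sub_le y j hln.le)
  have g2 := abs_le.1 (abs_rankCount_grid_sub_le y j (show l + 1 ≤ n from hln))
  have m1 : (rankCount y j ((l : ℝ) / n) : ℝ) / k ≤ (rankCount y j x : ℝ) / k := by
    gcongr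
    exact rankCount_mono y j h1'
  have m2 : (rankCount y j x : ℝ) / k ≤ (rankCount y j (((l + 1 : ℕ) : ℝ) / n) : ℝ) / k := by
    gcongr
    exact rankCount_mono y j h2'
  rw [abs_le]
  constructor <;> linarith [g1.1, g2.2]

/-- Within `[0, 1)` the event is the interval `[1 - U / k, 1)`, up to the uniform error `η` of the
empirical distribution; bounding the event and its complement gives both inequalities. -/
theorem abs_uniformLaw_sub_le (hk : 0 < k) {n : ℕ} (hn : 0 < n) (y : LayeredVertex k h → ℝ)
    (j : ℕ) {U : ℕ} (hU : U ≤ k) :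
    |uniformLaw.real {x | k < rankCount y j x + U} - (U : ℝ) / k| ≤
      1 / n + √(gridDeviation n y j) := by
  have hk' : (0 : ℝ) < k := by exact_mod_cast hk
  set η := 1 / (n : ℝ) + √(gridDeviation n y j) with hη
  have hη0 : 0 ≤ η := by positivity
  set m : ℝ := 1 - (U : ℝ) / k with hm
  have hm0 : 0 ≤ m := by
    have : (U : ℝ) / k ≤ 1 := by rw [div_le_one hk']; exact_mod_cast hU
    linarith
  have hm1 : m ≤ 1 := by
    have : 0 ≤ (U : ℝ) / k := by positivity
    linarith
  set A := {x : ℝ | k < rankCount y j x + U} with hA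
  have hAm : MeasurableSet A := by
    have : Measurable fun x => rankCount y j x + U :=
      ((rankCount_mono y j).measurable).add_const U
    exact measurableSet_lt measurable_const this
  have hA1 : uniformLaw.real A ≤ 1 - m + η := by
    have hsub : A ∩ Set.Ico 0 1 ⊆ Set.Ico (m - η) 1 := by
      rintro x ⟨hxA, hx⟩
      refine ⟨?_, hx.2⟩
      have hd := (abs_le.1 (abs_rankCount_sub_le hn y j hx)).2
      have : (k : ℝ) < rankCount y j x + U := by exact_mod_cast hxA
      have : 1 < (rankCount y j x : ℝ) / k + (U : ℝ) / k := by
        rw [← add_div, lt_div_iff₀ hk']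
        linarith
      linarith
    rw [measureReal_def, Measure.restrict_apply hAm]
    calc _ ≤ (volume (Set.Ico (m - η) 1)).toReal := by
          refine ENNReal.toReal_mono ?_ (measure_mono hsub)
          simp
      _ = 1 - m + η := by
          rw [Real.volume_Ico, ENNReal.toReal_ofReal (by linarith)]
          ring
  have hA2 : uniformLaw.real Aᶜ ≤ m + η := by
    have hsub : Aᶜ ∩ Set.Ico 0 1 ⊆ Set.Icc 0 (m + η) := by
      rintro x ⟨hxA, hx⟩
      refine ⟨hx.1, ?_⟩
      have hd := (abs_le.1 (abs_rankCount_sub_le hn y j hx)).1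
      have : (rankCount y j x : ℝ) + U ≤ k := by
        have : ¬ k < rankCount y j x + U := hxA
        have := not_lt.1 this
        exact_mod_cast this
      have : (rankCount y j x : ℝ) / k + (U : ℝ) / k ≤ 1 := by
        rw [← add_div, div_le_one hk']
        linarith
      linarith
    rw [measureReal_def, Measure.restrict_apply hAm.compl]
    calc _ ≤ (volume (Set.Icc 0 (m + η))).toReal := by
          refine ENNReal.toReal_mono ?_ (measure_mono hsub)
          simp
      _ = m + η := by
          rw [Real.volume_Icc, ENNReal.toReal_ofReal (by linarith)]
          ring
  rw [probReal_compl_eq_one_sub hAm] at hA2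
  rw [abs_le]
  constructor <;> linarith

/-! ### Second-moment control of the next group during the deadlines of one group. -/

/-- One step of size `s`: the fraction `U` drops by `s` with probability `q`, and the prediction `T`
is multiplied by `1 - s`. The new error has mean `(1 - s) * e - s * d`, whose square is at most `(1
- s) * e ^ 2 + s * d ^ 2` by convexity, and variance `s ^ 2 * q * (1 - q)`. -/
theorem sq_sub_average_le {s U T q d e : ℝ} (hs : 0 ≤ s) (hs1 : s ≤ 1) (hq : 0 ≤ q) (hq1 : q ≤ 1)
    (hd : q - U = d) (he : U - T = e) :
    q * (U - s - (1 - s) * T) ^ 2 + (1 - q) * (U - (1 - s) * T) ^ 2 ≤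
      e ^ 2 + s * d ^ 2 + s ^ 2 := by
  subst hd he
  have h1 : 0 ≤ s * (1 - s) * (q - T) ^ 2 := by
    have : 0 ≤ 1 - s := by linarith
    positivity
  have h2 : 0 ≤ s ^ 2 * (1 - q * (1 - q)) := by
    have : 0 ≤ 1 - q * (1 - q) := by nlinarith
    positivity
  have h3 : 0 ≤ s * (U - T) ^ 2 := by positivity
  nlinarith

/-- The difference between the unmatched fraction of group `i + 1` and its predicted value, before
the deadline of the `a`-th vertex of group `i`. -/
noncomputable def predictionError (y : LayeredVertex k h → ℝ) (i : Fin h) (a : ℕ) : ℝ :=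
  (unmatchedCount (matchingBefore y i a) (i + 1) : ℝ) / k -
    (1 - 1 / (k : ℝ)) ^ ((matchingBefore y i a).card - (matchingBefore y i 0).card)

open Classical in
/-- The prediction error after the deadline of the `a`-th vertex of group `i`, as a function of
the rank `x` of its pendant vertex. -/
noncomputable def nextError (y : LayeredVertex k h → ℝ) (i : Fin h) {a : ℕ} (ha : a < k)
    (c : ℕ) : ℝ :=
  if IsMatched (matchingBefore y i a) (Sum.inl (i, ⟨a, ha⟩)) then predictionError y i a
  else (unmatchedCount (matchingBefore y i a) (i + 1) : ℝ) / k -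
    (if k < c + unmatchedCount (matchingBefore y i a) (i + 1) then 1 / (k : ℝ) else 0) -
    (1 - 1 / (k : ℝ)) *
      (1 - 1 / (k : ℝ)) ^ ((matchingBefore y i a).card - (matchingBefore y i 0).card)

theorem card_matchingBefore_zero_le (y : LayeredVertex k h → ℝ) (i : Fin h) {a : ℕ} (ha : a ≤ k) :
    (matchingBefore y i 0).card ≤ (matchingBefore y i a).card := by
  induction a with
  | zero => rfl
  | succ a ih =>
    refine (ih (by omega)).trans ?_
    by_cases hM : IsMatched (matchingBefore y i a) (Sum.inl (i, ⟨a, ha⟩))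
    · rw [matchingBefore_succ_of_isMatched y i ha hM]
    · rw [card_matchingBefore_succ y i ha hM]
      omega

/-- This isolates the influence of the pendant's rank in the argument `c` of `nextError`; by
`nextError_update` nothing else there depends on it. -/
theorem predictionError_succ {y : LayeredVertex k h → ℝ} (hy : Function.Injective y) (i : Fin h)
    (hi : (i : ℕ) + 1 < h) {a : ℕ} (ha : a < k) :
    predictionError y i (a + 1) =
      nextError y i ha (rankCount y (i + 1) (y (Sum.inr (i, ⟨a, ha⟩)))) := by
  unfold nextError
  by_cases hM : IsMatched (matchingBefore y i a) (Sum.inl (i, ⟨a, ha⟩))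
  · rw [if_pos hM, predictionError, predictionError, matchingBefore_succ_of_isMatched y i ha hM]
  · rw [if_neg hM, predictionError, card_matchingBefore_succ y i ha hM,
      Nat.succ_sub (card_matchingBefore_zero_le y i ha.le), pow_succ']
    rw [← unmatchedCount_next_matchingBefore_succ hy i hi ha hM]
    push_cast
    rw [unmatchedCount_next_matchingBefore_succ hy i hi ha hM]
    split_ifs <;> ring

theorem orderInvariant_predictionError (i : Fin h) (a : ℕ) :
    OrderInvariant fun y : LayeredVertex k h → ℝ => predictionError y i a := by
  intro y y' hy
  have h1 : ∀ b, matchingBefore y i b = matchingBefore y' i b := fun b =>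
    orderInvariant_matchingAfter _ y y' hy
  simp only [predictionError, h1]

theorem orderInvariant_nextError (i : Fin h) {a : ℕ} (ha : a < k) :
    OrderInvariant fun y : LayeredVertex k h → ℝ =>
      nextError y i ha (rankCount y (i + 1) (y (Sum.inr (i, ⟨a, ha⟩)))) := by
  intro y y' hy
  have h1 : ∀ b, matchingBefore y i b = matchingBefore y' i b := fun b =>
    orderInvariant_matchingAfter _ y y' hy
  have h2 := orderInvariant_rankCount (i + 1) (Sum.inr (i, ⟨a, ha⟩)) y y' hy
  simp only at h2
  unfold nextError predictionError
  simp only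
  rw [h1 a, h1 0, h2]

theorem nextError_update (y : LayeredVertex k h → ℝ) (i : Fin h) {a : ℕ} (ha : a < k) (x : ℝ)
    (c : ℕ) : nextError (Function.update y (Sum.inr (i, ⟨a, ha⟩)) x) i ha c =
      nextError y i ha c := by
  unfold nextError predictionError
  rw [matchingBefore_update y i ha le_rfl, matchingBefore_update y i ha (Nat.zero_le a)]

theorem integral_nextError_sq_le (y : LayeredVertex k h → ℝ) (i : Fin h)
    {a : ℕ} (ha : a < k) {n : ℕ} (hn : 0 < n) :
    ∫ x, nextError y i ha (rankCount y (i + 1) x) ^ 2 ∂uniformLaw ≤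
      predictionError y i a ^ 2 +
        (1 / (k : ℝ)) * (2 * (1 / (n : ℝ)) ^ 2 + 2 * gridDeviation n y (i + 1)) +
          (1 / (k : ℝ)) ^ 2 := by
  classical
  have hk : 0 < k := by omega
  have hk' : (0 : ℝ) < k := by exact_mod_cast hk
  have hD := gridDeviation_nonneg n y (i + 1)
  -- A vertex already matched at its deadline changes nothing.
  by_cases hM : IsMatched (matchingBefore y i a) (Sum.inl (i, ⟨a, ha⟩))
  · simp only [nextError, if_pos hM, integral_const, probReal_univ, one_smul]
    have : 0 ≤ (1 / (k : ℝ)) * (2 * (1 / (n : ℝ)) ^ 2 + 2 * gridDeviation n y (i + 1)) +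
          (1 / (k : ℝ)) ^ 2 := by positivity
    linarith
  · set U := unmatchedCount (matchingBefore y i a) (i + 1) with hU
    set T := (1 - 1 / (k : ℝ)) ^ ((matchingBefore y i a).card - (matchingBefore y i 0).card)
      with hT
    set A := {x : ℝ | k < rankCount y (i + 1) x + U} with hA
    have hAm : MeasurableSet A :=
      measurableSet_lt measurable_const (((rankCount_mono y (i + 1)).measurable).add_const U)
    have heq : ∀ x, nextError y i ha (rankCount y (i + 1) x) ^ 2 =
        A.indicator (fun _ => ((U : ℝ) / k - 1 / k - (1 - 1 / (k : ℝ)) * T) ^ 2) x +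
          Aᶜ.indicator (fun _ => ((U : ℝ) / k - (1 - 1 / (k : ℝ)) * T) ^ 2) x := by
      intro x
      rw [nextError, if_neg hM, ← hU, ← hT]
      by_cases hx : x ∈ A
      · rw [Set.indicator_of_mem hx, Set.indicator_of_notMem (by simpa using hx),
          if_pos (show k < rankCount y (i + 1) x + U from hx), add_zero]
      · rw [Set.indicator_of_notMem hx, Set.indicator_of_mem hx,
          if_neg (show ¬ k < rankCount y (i + 1) x + U from hx), zero_add, sub_zero]
    simp_rw [heq]
    rw [integral_add ((integrable_const _).indicator hAm)
      ((integrable_const _).indicator hAm.compl), integral_indicator_const _ hAm,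
      integral_indicator_const _ hAm.compl, probReal_compl_eq_one_sub hAm, smul_eq_mul, smul_eq_mul]
    refine (sq_sub_average_le (s := 1 / (k : ℝ)) (by positivity) ?_ measureReal_nonneg
      measureReal_le_one rfl rfl).trans ?_
    · rw [div_le_one hk']
      exact_mod_cast hk
    · have hd := abs_uniformLaw_sub_le hk hn y (i + 1)
        (unmatchedCount_le (matchingBefore y i a) (i + 1))
      have hd2 : (uniformLaw.real A - (U : ℝ) / k) ^ 2 ≤
          2 * (1 / (n : ℝ)) ^ 2 + 2 * gridDeviation n y (i + 1) := by
        calc _ ≤ (1 / (n : ℝ) + √(gridDeviation n y (i + 1))) ^ 2 := by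
              rw [← sq_abs]
              gcongr
          _ ≤ 2 * (1 / (n : ℝ)) ^ 2 + 2 * √(gridDeviation n y (i + 1)) ^ 2 := by
              nlinarith [sq_nonneg (1 / (n : ℝ) - √(gridDeviation n y (i + 1)))]
          _ = _ := by rw [Real.sq_sqrt hD]
      have : (1 / (k : ℝ)) * (uniformLaw.real A - (U : ℝ) / k) ^ 2 ≤
          (1 / (k : ℝ)) * (2 * (1 / (n : ℝ)) ^ 2 + 2 * gridDeviation n y (i + 1)) := by gcongr
      exact add_le_add (add_le_add le_rfl this) le_rfl

theorem integrable_gridDeviation (n j : ℕ) :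
    Integrable (fun y => gridDeviation n y j) (rankLaw (LayeredVertex k h)) :=
  integrable_finsetSum _ fun _ _ => integrable_sq_rankCount j _

theorem integral_gridDeviation_le (hk : 0 < k) {n : ℕ} (hn : 0 < n) {j : ℕ} (hj : j < h) :
    ∫ y, gridDeviation n y j ∂(rankLaw (LayeredVertex k h)) ≤ (n + 1) / k := by
  have hn' : (0 : ℝ) < n := by exact_mod_cast hn
  simp only [gridDeviation]
  rw [integral_finsetSum _ fun _ _ => integrable_sq_rankCount j _]
  calc _ ≤ ∑ _l ∈ Finset.range (n + 1), 1 / (k : ℝ) := by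
        refine Finset.sum_le_sum fun l hl => integral_sq_rankCount_le hk hj (by positivity) ?_
        rw [div_le_one hn']
        exact_mod_cast Nat.lt_succ_iff.1 (Finset.mem_range.1 hl)
    _ = _ := by
        simp
        ring

/-- The rank of the `a`-th pendant is redrawn and averaged first, with all other ranks fixed; then
the grid deviation is averaged. -/
theorem integral_predictionError_sq_succ_le (i : Fin h) (hi : (i : ℕ) + 1 < h) {a : ℕ}
    (ha : a < k) {n : ℕ} (hn : 0 < n) :
    ∫ y, predictionError y i (a + 1) ^ 2 ∂(rankLaw (LayeredVertex k h)) ≤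
      ∫ y, predictionError y i a ^ 2 ∂(rankLaw (LayeredVertex k h)) +
        ((1 / (k : ℝ)) * (2 * (1 / (n : ℝ)) ^ 2 + 2 * ((n + 1) / k)) + (1 / (k : ℝ)) ^ 2) := by
  classical
  have hk : 0 < k := by omega
  have hI := ((orderInvariant_predictionError (k := k) i a).comp (· ^ 2)).integrable
  have hG := integrable_gridDeviation (k := k) (h := h) n (i + 1)
  have hG2 : Integrable (fun y : LayeredVertex k h → ℝ =>
      (1 / (k : ℝ)) * (2 * (1 / (n : ℝ)) ^ 2 + 2 * gridDeviation n y (i + 1)))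
      (rankLaw (LayeredVertex k h)) :=
    ((integrable_const _).add (hG.const_mul 2)).const_mul _
  have hN := ((orderInvariant_nextError i ha).comp (· ^ 2)).integrable
  calc _ = ∫ y, nextError y i ha (rankCount y (i + 1) (y (Sum.inr (i, ⟨a, ha⟩)))) ^ 2
        ∂(rankLaw (LayeredVertex k h)) := by
        refine integral_congr_ae (ae_injective_rankLaw.mono fun y hy => ?_)
        simp only [predictionError_succ hy i hi ha]
    _ = ∫ y, ∫ x, nextError y i ha (rankCount y (i + 1) x) ^ 2 ∂uniformLaw
        ∂(rankLaw (LayeredVertex k h)) := by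
        rw [integral_rankLaw_eq_integral_update (Sum.inr (i, ⟨a, ha⟩)) hN]
        simp only [nextError_update, Function.update_self, rankCount_update_inr]
    _ ≤ ∫ y, (predictionError y i a ^ 2 +
        (1 / (k : ℝ)) * (2 * (1 / (n : ℝ)) ^ 2 + 2 * gridDeviation n y (i + 1)) +
          (1 / (k : ℝ)) ^ 2) ∂(rankLaw (LayeredVertex k h)) := by
        refine integral_mono ?_ ?_ fun y => integral_nextError_sq_le y i ha hn
        · have := integrable_integral_update (Sum.inr (i, ⟨a, ha⟩)) hN
          simpa only [nextError_update, Function.update_self, rankCount_update_inr] using this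
        · exact (hI.add hG2).add (integrable_const _)
    _ = ∫ y, predictionError y i a ^ 2 ∂(rankLaw (LayeredVertex k h)) +
        ((1 / (k : ℝ)) * (2 * (1 / (n : ℝ)) ^ 2 +
          2 * ∫ y, gridDeviation n y (i + 1) ∂(rankLaw (LayeredVertex k h))) +
          (1 / (k : ℝ)) ^ 2) := by
        rw [integral_add (by exact hI.add hG2) (integrable_const _), integral_add hI hG2,
          integral_const_mul, integral_add (integrable_const _) (hG.const_mul 2)]
        simp only [integral_const_mul, integral_const, probReal_univ, one_smul]
        ring
    _ ≤ _ := by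
        gcongr
        exact integral_gridDeviation_le hk hn hi

/-- The error starts at 0, since the next group is untouched and the exponent is 0; then `k`
increments are summed. -/
theorem integral_predictionError_sq_le (i : Fin h) (hi : (i : ℕ) + 1 < h) (hk : 0 < k) {n : ℕ}
    (hn : 0 < n) :
    ∫ y, predictionError y i k ^ 2 ∂(rankLaw (LayeredVertex k h)) ≤
      2 * (1 / (n : ℝ)) ^ 2 + 2 * ((n + 1) / k) + 1 / k := by
  have hk' : (0 : ℝ) < k := by exact_mod_cast hk
  have key : ∀ a ≤ k, ∫ y, predictionError y i a ^ 2 ∂(rankLaw (LayeredVertex k h)) ≤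
      a * ((1 / (k : ℝ)) * (2 * (1 / (n : ℝ)) ^ 2 + 2 * ((n + 1) / k)) + (1 / (k : ℝ)) ^ 2) := by
    intro a ha
    induction a with
    | zero =>
      have : ∀ y : LayeredVertex k h → ℝ, predictionError y i 0 = 0 := fun y => by
        rw [predictionError, unmatchedCount_matchingBefore_zero y i hi]
        simp [hk'.ne']
      simp [this]
    | succ a ih =>
      refine (integral_predictionError_sq_succ_le i hi ha hn).trans ?_
      push_cast
      linarith [ih (by omega)]
  refine (key k le_rfl).trans (le_of_eq ?_)
  field_simp

/-! ### The approximate recursion from one group to the next. -/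

/-- The fraction of group `j` that is unmatched when the first deadline of the group is reached. -/
noncomputable def unmatchedFraction (y : LayeredVertex k h → ℝ) (j : ℕ) : ℝ :=
  (unmatchedCount (matchingAfter y (groupsBefore k h j)) j : ℝ) / k

theorem predictionError_self (y : LayeredVertex k h → ℝ) (i : Fin h) :
    predictionError y i k = unmatchedFraction y (i + 1) -
      (1 - 1 / (k : ℝ)) ^ unmatchedCount (matchingAfter y (groupsBefore k h i)) i := by
  rw [predictionError, card_matchingBefore_self, Nat.add_sub_cancel_left, unmatchedFraction]
  simp only [matchingBefore, indicesBefore_self, indicesBefore_zero]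

/-- The bases `1 - 1 / k` and `exp (-1 / k)` lie in `[0, 1]` and differ by at most `1 / k ^ 2`, and
at most `k` factors are compared. -/
theorem abs_one_sub_inv_pow_sub_exp_le (hk : 0 < k) {U : ℕ} (hU : U ≤ k) :
    |(1 - 1 / (k : ℝ)) ^ U - Real.exp (-((U : ℝ) / k))| ≤ 1 / k := by
  have hk' : (0 : ℝ) < k := by exact_mod_cast hk
  have hk1 : 1 / (k : ℝ) ≤ 1 := by
    rw [div_le_one hk']
    exact_mod_cast hk
  have hk0 : 0 ≤ 1 / (k : ℝ) := by positivity
  have hexp : Real.exp (-((U : ℝ) / k)) = Real.exp (-(1 / (k : ℝ))) ^ U := by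
    rw [← Real.exp_nat_mul]
    congr 1
    ring
  have habs : |(1 - 1 / (k : ℝ)) - Real.exp (-(1 / (k : ℝ)))| ≤ (1 / (k : ℝ)) ^ 2 := by
    have := Real.abs_exp_sub_one_sub_id_le (x := -(1 / (k : ℝ)))
      (by rwa [abs_neg, abs_of_nonneg hk0])
    rw [neg_sq] at this
    rw [abs_sub_comm]
    refine le_trans (le_of_eq ?_) this
    congr 1
    ring
  rw [hexp]
  refine (abs_pow_sub_pow_le _ _ _).trans ?_
  have hmax : max |1 - 1 / (k : ℝ)| |Real.exp (-(1 / (k : ℝ)))| ≤ 1 := by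
    refine max_le ?_ ?_
    · rw [abs_of_nonneg (by linarith)]
      linarith
    · rw [abs_of_pos (Real.exp_pos _), Real.exp_le_one_iff]
      linarith
  have hpow : max |1 - 1 / (k : ℝ)| |Real.exp (-(1 / (k : ℝ)))| ^ (U - 1) ≤ 1 :=
    pow_le_one₀ (le_max_of_le_left (abs_nonneg _)) hmax
  calc _ ≤ (1 / (k : ℝ)) ^ 2 * k * 1 := by
        gcongr
    _ = 1 / k := by field_simp

theorem unmatchedFraction_nonneg (y : LayeredVertex k h → ℝ) (j : ℕ) :
    0 ≤ unmatchedFraction y j := by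
  unfold unmatchedFraction
  positivity

theorem orderInvariant_unmatchedFraction (j : ℕ) :
    OrderInvariant fun y : LayeredVertex k h → ℝ => unmatchedFraction y j :=
  (orderInvariant_matchingAfter (groupsBefore k h j)).comp fun M => (unmatchedCount M j : ℝ) / k

theorem integral_abs_unmatchedFraction_succ_sub_le (hk : 0 < k) {j : ℕ} (hj : j + 1 < h) {n : ℕ}
    (hn : 0 < n) {η : ℝ} (hη : 0 < η) :
    ∫ y, |unmatchedFraction y (j + 1) - Real.exp (-unmatchedFraction y j)|
        ∂(rankLaw (LayeredVertex k h)) ≤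
      η + (2 * (1 / (n : ℝ)) ^ 2 + 2 * ((n + 1) / k) + 1 / k) / η + 1 / k := by
  set i : Fin h := ⟨j, by omega⟩ with hi
  have hI := ((orderInvariant_predictionError (k := k) i k).comp (· ^ 2)).integrable
  have hle : ∀ y : LayeredVertex k h → ℝ,
      |unmatchedFraction y (j + 1) - Real.exp (-unmatchedFraction y j)| ≤
        η + predictionError y i k ^ 2 / η + 1 / k := by
    intro y
    have h1 := abs_one_sub_inv_pow_sub_exp_le hk
      (unmatchedCount_le (matchingAfter y (groupsBefore k h j)) j)
    have h2 := predictionError_self y i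
    -- This turns the second-moment bound into a first-moment bound, with `η` free to be chosen
    -- later.
    have h3 : |predictionError y i k| ≤ η + predictionError y i k ^ 2 / η := by
      rw [← sq_abs, ← sub_nonneg]
      have : η + |predictionError y i k| ^ 2 / η - |predictionError y i k| =
          ((η - |predictionError y i k|) ^ 2 + η * |predictionError y i k|) / η := by
        field_simp
        ring
      rw [this]
      positivity
    have h4 : unmatchedFraction y (j + 1) - Real.exp (-unmatchedFraction y j) =
        predictionError y i k + ((1 - 1 / (k : ℝ)) ^ unmatchedCount
          (matchingAfter y (groupsBefore k h j)) j - Real.exp (-unmatchedFraction y j)) := by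
      rw [h2]
      simp only [hi]
      ring
    rw [h4]
    refine (abs_add_le _ _).trans ?_
    exact add_le_add h3 h1
  calc _ ≤ ∫ y, (η + predictionError y i k ^ 2 / η + 1 / k)
        ∂(rankLaw (LayeredVertex k h)) := by
        refine integral_mono (OrderInvariant.integrable ?_) ?_ hle
        · intro y y' hy
          have e1 := orderInvariant_unmatchedFraction j y y' hy
          have e2 := orderInvariant_unmatchedFraction (j + 1) y y' hy
          simp only at e1 e2
          simp only [e1, e2]
        · exact ((integrable_const _).add (hI.div_const _)).add (integrable_const _)
    _ = η + (∫ y, predictionError y i k ^ 2 ∂(rankLaw (LayeredVertex k h))) / η + 1 / k := by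
        rw [integral_add (by exact (integrable_const _).add (hI.div_const _)) (integrable_const _),
          integral_add (integrable_const _) (hI.div_const _), integral_div]
        simp
    _ ≤ _ := by
        gcongr
        exact integral_predictionError_sq_le i hj hk hn

/-- The unmatched fraction of a group is close in mean to `exp (-x)`, where `x` is that of the
group before it. -/
theorem exists_integral_abs_unmatchedFraction_succ_sub_le {ρ : ℝ} (hρ : 0 < ρ) :
    ∃ N : ℕ, ∀ k h j : ℕ, N ≤ k → j + 1 < h →
      ∫ y, |unmatchedFraction y (j + 1) - Real.exp (-unmatchedFraction y j)|
        ∂(rankLaw (LayeredVertex k h)) ≤ ρ := by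
  -- With `η = ρ / 4`, each of the three terms gets at most `ρ / 4`. The middle one needs its
  -- numerator at most `ρ ^ 2 / 16`: half comes from `1 / n ≤ ρ / 8`, half from `(2 * n + 3) / k ≤ ρ
  -- ^ 2 / 32`.
  obtain ⟨n, hn⟩ := exists_nat_gt (8 / ρ)
  have hn0 : (0 : ℝ) < n := lt_trans (by positivity) hn
  have hn1 : 0 < n := by exact_mod_cast hn0
  obtain ⟨N, hN⟩ := exists_nat_gt ((2 * n + 3) / (ρ ^ 2 / 32) + 4 / ρ)
  refine ⟨N, fun k h j hk hj => ?_⟩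
  have hNk : (N : ℝ) ≤ k := by exact_mod_cast hk
  have a1 : 0 < (2 * n + 3) / (ρ ^ 2 / 32) := by positivity
  have a2 : 0 < 4 / ρ := by positivity
  have hk0 : (0 : ℝ) < k := by linarith
  have hk1 : 0 < k := by exact_mod_cast hk0
  refine (integral_abs_unmatchedFraction_succ_sub_le hk1 hj hn1
    (η := ρ / 4) (by positivity)).trans ?_
  have b1 : 1 / (n : ℝ) ≤ ρ / 8 := by
    rw [div_le_iff₀ hn0]
    rw [div_lt_iff₀ hρ] at hn
    linarith
  have b2 : (1 / (n : ℝ)) ^ 2 ≤ (ρ / 8) ^ 2 := by gcongr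
  have b3 : (2 * n + 3) / (k : ℝ) ≤ ρ ^ 2 / 32 := by
    have : (2 * n + 3) / (ρ ^ 2 / 32) ≤ k := by linarith
    rw [div_le_iff₀ (by positivity)] at this
    rw [div_le_iff₀ hk0]
    linarith
  have b4 : 1 / (k : ℝ) ≤ ρ / 4 := by
    have : 4 / ρ ≤ k := by linarith
    rw [div_le_iff₀ hρ] at this
    rw [div_le_iff₀ hk0]
    linarith
  have b5 : (2 * (1 / (n : ℝ)) ^ 2 + 2 * ((n + 1) / k) + 1 / k) / (ρ / 4) ≤ ρ / 4 := by
    rw [div_le_iff₀ (by positivity)]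
    have : 2 * (((n : ℝ) + 1) / k) + 1 / k = (2 * n + 3) / k := by ring
    nlinarith
  linarith

end Layered

/-! ### The Omega constant and the contraction towards it. -/

section Omega

theorem exists_eq_exp_neg :
    ∃ Ω : ℝ, Ω = Real.exp (-Ω) ∧ (0.56714 : ℝ) < Ω ∧ Ω < (0.56715 : ℝ) := by
  have hcont : ContinuousOn (fun x : ℝ => x * Real.exp x) (Set.Icc 0.56714 0.56715) := by
    fun_prop
  have h1 : (0.56714 : ℝ) * Real.exp 0.56714 < 1 := by
    -- Ten Taylor terms leave a remainder of order `10⁻⁹`, well below the gap of order `10⁻⁵` to 1.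
    have := Real.exp_bound' (x := 0.56714) (by norm_num) (by norm_num) (n := 10) (by norm_num)
    simp only [Finset.sum_range_succ, Finset.sum_range_zero, Nat.factorial] at this
    norm_num at this
    norm_num
    linarith
  have h2 : 1 < (0.56715 : ℝ) * Real.exp 0.56715 := by
    have := Real.sum_le_exp_of_nonneg (x := 0.56715) (by norm_num) 10
    simp only [Finset.sum_range_succ, Finset.sum_range_zero, Nat.factorial] at this
    norm_num at this
    norm_num
    linarith
  obtain ⟨Ω, ⟨ha, hb⟩, hΩ⟩ := intermediate_value_Ioo (by norm_num) hcont ⟨h1, h2⟩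
  refine ⟨Ω, ?_, ha, hb⟩
  rw [Real.exp_neg]
  exact eq_inv_of_mul_eq_one_left hΩ

theorem eq_of_eq_exp_neg {x z : ℝ} (hx : x = Real.exp (-x)) (hz : z = Real.exp (-z)) : x = z := by
  rcases lt_trichotomy x z with hlt | rfl | hlt
  · have := Real.exp_lt_exp.2 (neg_lt_neg hlt)
    linarith
  · rfl
  · have := Real.exp_lt_exp.2 (neg_lt_neg hlt)
    linarith

/-- `x ↦ exp (-x)` contracts distances to its fixed point. -/
theorem abs_exp_neg_sub_le {Ω : ℝ} (hΩ : Ω = Real.exp (-Ω)) (h0 : 0 < Ω)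
    (h1 : Ω < (0.56715 : ℝ)) {x : ℝ} (hx : 0 ≤ x) :
    |Real.exp (-x) - Ω| ≤ 9 / 10 * |x - Ω| := by
  have heq : Real.exp (-x) = Ω * Real.exp (Ω - x) := by
    calc Real.exp (-x) = Real.exp (-Ω) * Real.exp (Ω - x) := by
          rw [← Real.exp_add]
          congr 1
          ring
      _ = Ω * Real.exp (Ω - x) := by rw [← hΩ]
  norm_num at h1
  rcases le_total Ω x with hle | hle
  · have hexp := Real.add_one_le_exp (Ω - x)
    have hmono : Real.exp (Ω - x) ≤ 1 := Real.exp_le_one_iff.2 (by linarith)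
    rw [abs_of_nonpos (by rw [heq]; nlinarith), abs_of_nonneg (by linarith), heq]
    nlinarith
  -- Below `Ω` the map is steeper. With `t = Ω - x ≤ Ω` and `exp t - 1 ≤ t + t ^ 2`, the factor is
  -- at most `Ω * (1 + Ω) < 0.89`, which is where `9 / 10` comes from.
  · have hexp := (abs_le.1 (Real.abs_exp_sub_one_sub_id_le (x := Ω - x)
      (by rw [abs_of_nonneg (by linarith)]; linarith))).2
    have hmono : 1 ≤ Real.exp (Ω - x) := Real.one_le_exp (by linarith)
    rw [abs_of_nonneg (by rw [heq]; nlinarith), abs_of_nonpos (by linarith), heq]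
    have ht : 0 ≤ Ω - x := by linarith
    have hfac : Ω * (1 + (Ω - x)) ≤ 9 / 10 := by nlinarith
    calc Ω * Real.exp (Ω - x) - Ω = Ω * (Real.exp (Ω - x) - 1) := by ring
      _ ≤ Ω * ((Ω - x) + (Ω - x) ^ 2) := by
          gcongr
          linarith
      _ = (Ω * (1 + (Ω - x))) * (Ω - x) := by ring
      _ ≤ 9 / 10 * (Ω - x) := by gcongr
      _ = 9 / 10 * -(x - Ω) := by ring

end Omega

/-! ### Bipartiteness and the maximum matching of the layered graph. -/

section Layered

variable {k h : ℕ}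

theorem isBipartite_layeredGraph (k h : ℕ) : (layeredGraph k h).IsBipartite := by
  let C : (layeredGraph k h).Coloring Bool := SimpleGraph.Coloring.mk
    (Sum.elim (fun p => decide ((p.1 : ℕ) % 2 = 0)) fun p => decide ((p.1 : ℕ) % 2 = 1)) (by
      rintro (p | p) (q | q) hpq
      · rw [layeredGraph_adj_inl_inl] at hpq
        simp only [Sum.elim_inl, ne_eq, decide_eq_decide]
        omega
      · obtain rfl := layeredGraph_adj_inl_inr.1 hpq
        simp only [Sum.elim_inl, Sum.elim_inr, ne_eq, decide_eq_decide]
        omega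
      · obtain rfl := layeredGraph_adj_inr_inl.1 hpq
        simp only [Sum.elim_inl, Sum.elim_inr, ne_eq, decide_eq_decide]
        omega
      · exact absurd hpq layeredGraph_adj_inr_inr)
  exact C.colorable

/-- The perfect matching of the layered graph. -/
def pendantMatching (k h : ℕ) : (layeredGraph k h).Subgraph where
  verts := Set.univ
  Adj u v := ∃ p, u = Sum.inl p ∧ v = Sum.inr p ∨ u = Sum.inr p ∧ v = Sum.inl p
  adj_sub := by
    rintro _ _ ⟨p, ⟨rfl, rfl⟩ | ⟨rfl, rfl⟩⟩
    · exact layeredGraph_adj_inl_inr.2 rfl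
    · exact layeredGraph_adj_inr_inl.2 rfl
  edge_vert _ := Set.mem_univ _
  symm := ⟨fun _ _ ⟨p, hp⟩ => ⟨p, hp.symm.imp And.symm And.symm⟩⟩

theorem isMatching_pendantMatching (k h : ℕ) : (pendantMatching k h).IsMatching := by
  rintro (p | p) -
  · refine ⟨Sum.inr p, ⟨p, Or.inl ⟨rfl, rfl⟩⟩, ?_⟩
    rintro _ ⟨q, ⟨hq, rfl⟩ | ⟨hq, rfl⟩⟩
    · rw [Sum.inl_injective hq]
    · exact absurd hq (by simp)
  · refine ⟨Sum.inl p, ⟨p, Or.inr ⟨rfl, rfl⟩⟩, ?_⟩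
    rintro _ ⟨q, ⟨hq, rfl⟩ | ⟨hq, rfl⟩⟩
    · exact absurd hq (by simp)
    · rw [Sum.inr_injective hq]

theorem ncard_edgeSet_pendantMatching (k h : ℕ) :
    (pendantMatching k h).edgeSet.ncard = k * h := by
  have : (pendantMatching k h).edgeSet = (fun p : Fin h × Fin k =>
      (s(Sum.inl p, Sum.inr p) : Sym2 (LayeredVertex k h))) '' Set.univ := by
    ext e
    induction e using Sym2.ind with
    | _ u v =>
      simp only [SimpleGraph.Subgraph.mem_edgeSet, pendantMatching, Set.mem_image, Set.mem_univ,
        true_and, Sym2.eq_iff]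
      refine exists_congr fun p => ?_
      tauto
  rw [this, Set.ncard_image_of_injective, Set.ncard_univ, Nat.card_eq_fintype_card]
  · simp [mul_comm]
  · intro p q hpq
    simpa using hpq

/-- The `k * h` group vertices form a vertex cover; sending an edge of a matching to a group
endpoint is injective. -/
theorem ncard_edgeSet_le_of_isMatching (M : (layeredGraph k h).Subgraph) (hM : M.IsMatching) :
    M.edgeSet.ncard ≤ k * h := by
  have hex : ∀ e ∈ M.edgeSet, ∃ p u, e = s(Sum.inl p, u) := by
    intro e
    induction e using Sym2.ind with
    | _ u v =>
      intro huv
      rcases u with p | p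
      · exact ⟨p, v, rfl⟩
      · rcases v with q | q
        · exact ⟨q, _, Sym2.eq_swap⟩
        · exact absurd (M.adj_sub huv) layeredGraph_adj_inr_inr
  rcases M.edgeSet.eq_empty_or_nonempty with hempty | ⟨e₀, he₀⟩
  · simp [hempty]
  obtain ⟨p₀, u₀, -⟩ := hex e₀ he₀
  have : Nonempty (Fin h × Fin k) := ⟨p₀⟩
  choose! f g hfg using hex
  have hinj : Set.InjOn f M.edgeSet := by
    intro e he e' he' hee
    have h1 := hfg e he
    have h2 := hfg e' he'
    rw [h1, SimpleGraph.Subgraph.mem_edgeSet] at he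
    rw [h2, SimpleGraph.Subgraph.mem_edgeSet, ← hee] at he'
    rw [h1, h2, ← hee, hM.eq_of_adj_left he he']
  have := Set.ncard_le_ncard_of_injOn f (t := Set.univ) (fun _ _ => Set.mem_univ _) hinj
    (Set.toFinite _)
  rw [Set.ncard_univ, Nat.card_eq_fintype_card] at this
  simpa [mul_comm] using this

theorem maxMatching_layeredGraph (k h : ℕ) : maxMatching (layeredGraph k h) = k * h := by
  refine IsGreatest.csSup_eq ⟨⟨pendantMatching k h, isMatching_pendantMatching k h,
    ncard_edgeSet_pendantMatching k h⟩, ?_⟩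
  rintro _ ⟨M, hM, rfl⟩
  exact ncard_edgeSet_le_of_isMatching M hM

/-! ### Convergence of the unmatched fractions and of the matching size. -/

theorem unmatchedFraction_zero (hk : 0 < k) (hh : 0 < h) (y : LayeredVertex k h → ℝ) :
    unmatchedFraction y 0 = 1 := by
  rw [unmatchedFraction, unmatchedCount_groupsBefore_zero y hh, div_self]
  exact_mod_cast hk.ne'

theorem integrable_abs_unmatchedFraction_sub (j : ℕ) (x : ℝ) :
    Integrable (fun y => |unmatchedFraction y j - x|) (rankLaw (LayeredVertex k h)) :=
  ((orderInvariant_unmatchedFraction j).comp fun z => |z - x|).integrable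

/-- The unmatched fraction of group `j` converges in mean to the fixed point of `exp (-x)`. -/
theorem exists_integral_abs_unmatchedFraction_sub_le {Ω : ℝ} (hΩ : Ω = Real.exp (-Ω))
    (h0 : 0 < Ω) (h1 : Ω < (0.56715 : ℝ)) {ρ : ℝ} (hρ : 0 < ρ) :
    ∃ N : ℕ, ∀ k h j : ℕ, N ≤ k → j < h →
      ∫ y, |unmatchedFraction y j - Ω| ∂(rankLaw (LayeredVertex k h)) ≤ (9 / 10) ^ j + ρ := by
  -- An error `ρ / 10` per group is what the contraction absorbs: `ρ / 10 + 9 / 10 * ρ = ρ`.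
  obtain ⟨N, hN⟩ := exists_integral_abs_unmatchedFraction_succ_sub_le
    (show 0 < ρ / 10 by positivity)
  refine ⟨max N 1, fun k h j hk hj => ?_⟩
  have hk0 : 0 < k := by omega
  induction j with
  | zero =>
    simp only [unmatchedFraction_zero hk0 hj, integral_const, probReal_univ, one_smul]
    norm_num at h1
    rw [abs_of_nonneg (by linarith), pow_zero]
    linarith
  | succ j ih =>
    have hI : Integrable (fun y => |unmatchedFraction y (j + 1) -
        Real.exp (-unmatchedFraction y j)|) (rankLaw (LayeredVertex k h)) := by
      refine OrderInvariant.integrable fun y y' hy => ?_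
      have e1 := orderInvariant_unmatchedFraction j y y' hy
      have e2 := orderInvariant_unmatchedFraction (j + 1) y y' hy
      simp only at e1 e2
      simp only [e1, e2]
    have hI' := integrable_abs_unmatchedFraction_sub (k := k) (h := h) j Ω
    calc _ ≤ ∫ y, (|unmatchedFraction y (j + 1) - Real.exp (-unmatchedFraction y j)| +
          9 / 10 * |unmatchedFraction y j - Ω|) ∂(rankLaw (LayeredVertex k h)) := by
          refine integral_mono (integrable_abs_unmatchedFraction_sub _ _)
            (hI.add (hI'.const_mul _)) fun y => ?_
          exact (abs_sub_le _ (Real.exp (-unmatchedFraction y j)) _).trans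
            (add_le_add le_rfl (abs_exp_neg_sub_le hΩ h0 h1 (unmatchedFraction_nonneg y j)))
      _ ≤ ρ / 10 + 9 / 10 * ((9 / 10) ^ j + ρ) := by
          rw [integral_add hI (hI'.const_mul _), integral_const_mul]
          gcongr
          · exact hN k h j (by omega) hj
          · exact ih (by omega)
      _ = _ := by ring

/-- The deviation of the relative size of the matching from `Ω`. -/
noncomputable def ratioError (Ω : ℝ) (y : LayeredVertex k h → ℝ) : ℝ :=
  ((ranking (layeredInstance k h) y).card : ℝ) / ((k : ℝ) * (h : ℝ)) - Ω

theorem orderInvariant_card_ranking :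
    OrderInvariant fun y : LayeredVertex k h → ℝ =>
      ((ranking (layeredInstance k h) y).card : ℝ) := by
  simp_rw [ranking_layeredInstance]
  exact (orderInvariant_matchingAfter _).comp fun M => (M.card : ℝ)

theorem integrable_ratioError (Ω : ℝ) :
    Integrable (fun y => ratioError Ω y) (rankLaw (LayeredVertex k h)) :=
  (orderInvariant_card_ranking.comp fun z => z / ((k : ℝ) * (h : ℝ)) - Ω).integrable

theorem ratioError_eq (Ω : ℝ) (hk : 0 < k) (hh : 0 < h) (y : LayeredVertex k h → ℝ) :
    ratioError Ω y = (1 / h) * ∑ j ∈ Finset.range h, (unmatchedFraction y j - Ω) := by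
  have hk' : (k : ℝ) ≠ 0 := by exact_mod_cast hk.ne'
  have hh' : (h : ℝ) ≠ 0 := by exact_mod_cast hh.ne'
  rw [ratioError, card_ranking_layeredInstance, Finset.sum_sub_distrib]
  simp only [unmatchedFraction, ← Finset.sum_div, Finset.sum_const, Finset.card_range,
    nsmul_eq_mul]
  push_cast
  field_simp

/-- The transient `(9 / 10) ^ j` sums to at most 10, so it contributes at most `10 / h` to the
average over the groups. The threshold on `k` is uniform in `h`, so no relation between `k` and `h`
is needed. -/
theorem eventually_integral_abs_ratioError_le {Ω : ℝ} (hΩ : Ω = Real.exp (-Ω))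
    (h0 : 0 < Ω) (h1 : Ω < (0.56715 : ℝ)) {ρ : ℝ} (hρ : 0 < ρ) :
    ∀ᶠ p : ℕ × ℕ in atTop ×ˢ atTop, 0 < p.1 ∧ 0 < p.2 ∧
      ∫ y, |ratioError Ω y| ∂(rankLaw (LayeredVertex p.1 p.2)) ≤ ρ := by
  obtain ⟨N, hN⟩ := exists_integral_abs_unmatchedFraction_sub_le hΩ h0 h1
    (show 0 < ρ / 2 by positivity)
  obtain ⟨H, hH⟩ := exists_nat_gt (20 / ρ)
  filter_upwards [(eventually_ge_atTop (max N 1)).prod_mk (eventually_ge_atTop (max H 1))]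
    with ⟨k, h⟩ hkh
  simp only at hkh ⊢
  have hk : 0 < k := by omega
  have hh : 0 < h := by omega
  refine ⟨hk, hh, ?_⟩
  have hh' : (0 : ℝ) < h := by exact_mod_cast hh
  have hHh : (H : ℝ) ≤ h := by
    have : H ≤ h := by omega
    exact_mod_cast this
  have hsum : ∑ j ∈ Finset.range h, (9 / 10 : ℝ) ^ j ≤ 10 := by
    have := geom_sum_eq (show (9 / 10 : ℝ) ≠ 1 by norm_num) h
    rw [this, show ((9 / 10 : ℝ) ^ h - 1) / (9 / 10 - 1) = 10 * (1 - (9 / 10) ^ h) by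
      norm_num
      ring]
    have : 0 ≤ (9 / 10 : ℝ) ^ h := by positivity
    linarith
  calc _ ≤ ∫ y, (1 / (h : ℝ)) * ∑ j ∈ Finset.range h, |unmatchedFraction y j - Ω|
        ∂(rankLaw (LayeredVertex k h)) := by
        refine integral_mono (integrable_ratioError Ω).abs ((integrable_finsetSum _ fun j _ =>
          integrable_abs_unmatchedFraction_sub j Ω).const_mul _) fun y => ?_
        simp only [ratioError_eq Ω hk hh y]
        rw [abs_mul, abs_of_nonneg (by positivity)]
        gcongr
        exact Finset.abs_sum_le_sum_abs _ _
    _ ≤ (1 / (h : ℝ)) * ∑ j ∈ Finset.range h, ((9 / 10 : ℝ) ^ j + ρ / 2) := by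
        rw [integral_const_mul, integral_finsetSum _ fun j _ =>
          integrable_abs_unmatchedFraction_sub j Ω]
        gcongr with j hj
        exact hN k h j (by omega) (Finset.mem_range.1 hj)
    _ ≤ (1 / (h : ℝ)) * (10 + h * (ρ / 2)) := by
        rw [Finset.sum_add_distrib]
        simp only [Finset.sum_const, Finset.card_range, nsmul_eq_mul]
        gcongr
    _ ≤ ρ := by
        rw [div_lt_iff₀ hρ] at hH
        rw [one_div, inv_mul_le_iff₀ hh']
        nlinarith

theorem expectedRanking_div_sub (Ω : ℝ) :
    expectedRanking (layeredInstance k h) / (maxMatching (layeredInstance k h).graph : ℝ) - Ω =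
      ∫ y, ratioError Ω y ∂(rankLaw (LayeredVertex k h)) := by
  have hm : maxMatching (layeredInstance k h).graph = k * h := maxMatching_layeredGraph k h
  unfold ratioError
  rw [hm, integral_sub (by exact (orderInvariant_card_ranking.comp
    fun z => z / ((k : ℝ) * (h : ℝ))).integrable) (integrable_const _), integral_div]
  simp [expectedRanking]

theorem measureReal_le_abs_le {V : Type*} [Fintype V] {f : (V → ℝ) → ℝ}
    (hf : Integrable f (rankLaw V)) {ε : ℝ} (hε : 0 < ε) :
    (rankLaw V).real {y | ε ≤ |f y|} ≤ (∫ y, |f y| ∂(rankLaw V)) / ε := by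
  rw [le_div_iff₀ hε, mul_comm]
  exact mul_meas_ge_le_integral_of_nonneg (Eventually.of_forall fun y => abs_nonneg _) hf.abs ε

theorem tendsto_measureReal_ratioError {Ω : ℝ} (hΩ : Ω = Real.exp (-Ω))
    (h0 : 0 < Ω) (h1 : Ω < (0.56715 : ℝ)) {ε : ℝ} (hε : 0 < ε) :
    Tendsto (fun p : ℕ × ℕ => (rankLaw (LayeredVertex p.1 p.2)).real {y | ε ≤ |ratioError Ω y|})
      (atTop ×ˢ atTop) (𝓝 0) := by
  rw [Metric.tendsto_nhds]
  intro δ hδ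
  filter_upwards [eventually_integral_abs_ratioError_le hΩ h0 h1
    (show 0 < δ / 2 * ε by positivity)] with p hp
  rw [Real.dist_eq, sub_zero, abs_of_nonneg measureReal_nonneg]
  refine (measureReal_le_abs_le (integrable_ratioError Ω) hε).trans_lt ?_
  rw [div_lt_iff₀ hε]
  nlinarith [hp.2.2, mul_pos hδ hε]

theorem matchedPendants_div_sub (Ω : ℝ) (hk : 0 < k) (hh : 0 < h) (y : LayeredVertex k h → ℝ) :
    (matchedPendants k h y : ℝ) / ((k : ℝ) * (h : ℝ)) - (2 * Ω - 1) = 2 * ratioError Ω y := by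
  have hk' : (k : ℝ) ≠ 0 := by exact_mod_cast hk.ne'
  have hh' : (h : ℝ) ≠ 0 := by exact_mod_cast hh.ne'
  have : (k : ℝ) * h + matchedPendants k h y = 2 * (ranking (layeredInstance k h) y).card := by
    exact_mod_cast matchedPendants_add y
  rw [ratioError, eq_sub_of_add_eq' this]
  field_simp
  ring

theorem tendsto_expectedRanking_div {Ω : ℝ} (hΩ : Ω = Real.exp (-Ω))
    (h0 : 0 < Ω) (h1 : Ω < (0.56715 : ℝ)) :
    Tendsto (fun p : ℕ × ℕ => expectedRanking (layeredInstance p.1 p.2) /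
      (maxMatching (layeredInstance p.1 p.2).graph : ℝ)) (atTop ×ˢ atTop) (𝓝 Ω) := by
  rw [Metric.tendsto_nhds]
  intro δ hδ
  filter_upwards [eventually_integral_abs_ratioError_le hΩ h0 h1
    (show 0 < δ / 2 by positivity)] with p hp
  rw [Real.dist_eq, expectedRanking_div_sub]
  exact (abs_integral_le_integral_abs.trans hp.2.2).trans_lt (by linarith)

end Layered

end FullyOnline

theorem mainTheorem4 :
    ∃ Ω : ℝ,
      -- `Ω` is the Omega constant, the unique solution of `x = exp (-x)`
      Ω = Real.exp (-Ω) ∧ (∀ x : ℝ, x = Real.exp (-x) → x = Ω) ∧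
      (0.56714 : ℝ) < Ω ∧ Ω < (0.56715 : ℝ) ∧
      -- Ranking is at most `Ω`-competitive for Fully Online Bipartite Matching
      (∀ c : ℝ, FullyOnline.RankingIsCompetitive c → c ≤ Ω) ∧
      -- the layered instances are bipartite and have a maximum matching of size `k * h`
      (∀ k h : ℕ, (FullyOnline.layeredInstance k h).graph.IsBipartite ∧
        FullyOnline.maxMatching (FullyOnline.layeredInstance k h).graph = k * h) ∧
      -- the ratio of Ranking on the layered instances tends to `Ω` as `k, h → ∞`
      Tendsto (fun p : ℕ × ℕ =>
          FullyOnline.expectedRanking (FullyOnline.layeredInstance p.1 p.2) /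
            (FullyOnline.maxMatching (FullyOnline.layeredInstance p.1 p.2).graph : ℝ))
        (atTop ×ˢ atTop) (𝓝 Ω) ∧
      -- the size of the matching, relative to the maximum, concentrates at `Ω`
      (∀ ε : ℝ, 0 < ε → Tendsto (fun p : ℕ × ℕ =>
          (FullyOnline.rankLaw (FullyOnline.LayeredVertex p.1 p.2)).real
            {y | ε ≤ |((FullyOnline.ranking (FullyOnline.layeredInstance p.1 p.2) y).card : ℝ) /
              ((p.1 : ℝ) * (p.2 : ℝ)) - Ω|})
        (atTop ×ˢ atTop) (𝓝 0)) ∧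
      -- the fraction of matched pendants concentrates at `2 * Ω - 1`
      (∀ ε : ℝ, 0 < ε → Tendsto (fun p : ℕ × ℕ =>
          (FullyOnline.rankLaw (FullyOnline.LayeredVertex p.1 p.2)).real
            {y | ε ≤ |(FullyOnline.matchedPendants p.1 p.2 y : ℝ) /
              ((p.1 : ℝ) * (p.2 : ℝ)) - (2 * Ω - 1)|})
        (atTop ×ˢ atTop) (𝓝 0)) ∧
      -- the fraction of the `i`-th group that is unmatched when the first deadline of the group
      -- is reached concentrates at `Ω` as `k, i → ∞`
      (∀ ε : ℝ, 0 < ε → ∃ N : ℕ, ∀ (k h : ℕ) (hk : 0 < k) (i : Fin h), N ≤ k → N ≤ (i : ℕ) →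
        (FullyOnline.rankLaw (FullyOnline.LayeredVertex k h)).real
          {y | ε ≤ |(FullyOnline.unmatchedInGroup k h hk i y : ℝ) / (k : ℝ) - Ω|} ≤ ε) := by
  obtain ⟨Ω, hΩ, ha, hb⟩ := FullyOnline.exists_eq_exp_neg
  have h0 : 0 < Ω := lt_trans (by norm_num) ha
  have hlim := FullyOnline.tendsto_expectedRanking_div hΩ h0 hb
  refine ⟨Ω, hΩ, fun x hx => FullyOnline.eq_of_eq_exp_neg hx hΩ, ha, hb, ?_, ?_, hlim, ?_, ?_, ?_⟩
  · intro c hc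
    refine ge_of_tendsto hlim ?_
    -- The tolerance 1 is immaterial; only the positivity of `k` and `h` is used.
    filter_upwards [FullyOnline.eventually_integral_abs_ratioError_le hΩ h0 hb one_pos] with p hp
    have hpos : 0 < FullyOnline.maxMatching (FullyOnline.layeredInstance p.1 p.2).graph :=
      (Nat.mul_pos hp.1 hp.2.1).trans_eq (FullyOnline.maxMatching_layeredGraph p.1 p.2).symm
    rw [le_div_iff₀ (by exact_mod_cast hpos)]
    exact hc _ _ (FullyOnline.isBipartite_layeredGraph p.1 p.2)
  · exact fun k h => ⟨FullyOnline.isBipartite_layeredGraph k h,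
      FullyOnline.maxMatching_layeredGraph k h⟩
  · exact fun ε hε => FullyOnline.tendsto_measureReal_ratioError hΩ h0 hb hε
  · intro ε hε
    -- The pendant deviation is twice `ratioError`, hence the threshold `ε / 2`.
    refine (FullyOnline.tendsto_measureReal_ratioError hΩ h0 hb (half_pos hε)).congr' ?_
    filter_upwards [FullyOnline.eventually_integral_abs_ratioError_le hΩ h0 hb one_pos] with p hp
    congr 1
    ext y
    rw [Set.mem_ofPred_eq, Set.mem_ofPred_eq,
      FullyOnline.matchedPendants_div_sub Ω hp.1 hp.2.1, abs_mul, abs_two, div_le_iff₀' two_pos]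
  · intro ε hε
    -- Markov's inequality divides the mean by `ε`, so the mean must be at most `ε ^ 2`: half for
    -- `ρ` and half for `(9 / 10) ^ i`.
    obtain ⟨N, hN⟩ := FullyOnline.exists_integral_abs_unmatchedFraction_sub_le hΩ h0 hb
      (show 0 < ε ^ 2 / 2 by positivity)
    obtain ⟨m, hm⟩ := exists_pow_lt_of_lt_one (show 0 < ε ^ 2 / 2 by positivity)
      (show (9 / 10 : ℝ) < 1 by norm_num)
    refine ⟨max N m, fun k h hk i hNk hNi => ?_⟩
    have hset : {y : FullyOnline.LayeredVertex k h → ℝ |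
        ε ≤ |(FullyOnline.unmatchedInGroup k h hk i y : ℝ) / (k : ℝ) - Ω|} =
        {y | ε ≤ |FullyOnline.unmatchedFraction y i - Ω|} := by
      ext y
      rw [Set.mem_ofPred_eq, Set.mem_ofPred_eq, FullyOnline.unmatchedInGroup_eq,
        FullyOnline.matchingBefore, FullyOnline.indicesBefore_zero]
      rfl
    rw [hset]
    refine (FullyOnline.measureReal_le_abs_le (((FullyOnline.orderInvariant_unmatchedFraction
      (k := k) (i : ℕ)).comp fun z => z - Ω).integrable) hε).trans ?_
    rw [div_le_iff₀ hε]
    have hpow : (9 / 10 : ℝ) ^ (i : ℕ) ≤ (9 / 10) ^ m :=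
      pow_le_pow_of_le_one (by norm_num) (by norm_num) (by omega)
    have := hN k h i (by omega) i.2
    nlinarith
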